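/- Let $d\ge 0$, $\gamma\in[0,1/2]$ and $s\ge 0$ be fixed. $G^{\mathrm{bip}}_{n,d}$ is the random bipartite graph with parts $L,R$ of size $n$ in which each pair in $L\times R$ is an edge independently with probability $d/n$ (truncated to $1$ if $n<d$). An *$s$-local function* $g=g(H,\mathbf x)$ takes a finite rooted graph $H$ of depth at most $s$ with labels $\mathbf x\in[0,1]^{V(H)}$ and returns a bit in $\{0,1\}$; it is measurable in $\mathbf x$ and invariant under isomorphisms of rooted labelled graphs. It is applied at a vertex $v$ of a graph by evaluating it on the depth-$s$ neighborhood of $v$, rooted at $v$, with the restricted labels. A pair $(g_\ell,g_r)$ of $s$-local functions is *compatible* if for every finite bipartite graph $G$ with bipartition $(L,R)$ and all $\mathbf x\in[0,1]^{V(G)}$, the set of vertices at which the output is $1$, when $g_\ell$ is applied at the vertices of $L$ and $g_r$ at those of $R$, is independent. An independent set $I$ is *$\gamma$-balanced* if $\big||I\cap L|-\gamma|I|\big|<1$. Put $$\alpha_{d,\gamma}(g_\ell,g_r)=\frac12\min\Big\{\frac1\gamma\,\mathbb E[g_\ell(\mathbf T,\mathbf x)],\ \frac1{1-\gamma}\,\mathbb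 E[g_r(\mathbf T,\mathbf x)]\Big\},$$ where $\mathbf T$ is the rooted $\mathrm{Pois}(d)$ Galton--Watson tree, $\mathbf x$ are iid $\mathrm{Unif}[0,1]$ labels on its vertices, and $g(\mathbf T,\mathbf x)$ is $g$ applied at the root; for $\gamma=0$ the minimum is read as its second term. **Lemma.** Let $(g_\ell,g_r)$ be a compatible pair of $s$-local functions. Let $X$ be the random independent set obtained by applying $(g_\ell,g_r)$ to $G^{\mathrm{bip}}_{n,d}$ with iid $\mathrm{Unif}[0,1]$ vertex labels, and let $X_\gamma$ be a largest $\gamma$-balanced independent set contained in $X$. Then with high probability over the graph and the labels $$\frac{|X_\gamma|}{2n}=\alpha_{d,\gamma}(g_\ell,g_r)+o(1),$$ that is, for every $\varepsilon>0$, $\ \mathbb P\Big(\Big|\frac{|X_\gamma|}{2n}-\alpha_{d,\gamma}(g_\ell,g_r)\Big|>\varepsilon\Big)\to0$ as $n\to\infty$. -/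

import Mathlib

open MeasureTheory ProbabilityTheory Filter Topology
open scoped unitInterval NNReal

namespace BipLocal

/-! ### Rooted graphs of bounded depth and neighborhoods -/

/-- The rooted graph `(H, r)` has depth at most `s`: every vertex can be reached from the root `r`
by a walk of length at most `s`. In particular `H` is connected. -/
def HasDepthLE {V : Type} (H : SimpleGraph V) (r : V) (s : ℕ) : Prop :=
  ∀ u : V, ∃ w : H.Walk r u, w.length ≤ s

/-- The set of vertices at graph distance at most `s` from `v`. -/
def nbhd {V : Type} (G : SimpleGraph V) (s : ℕ) (v : V) : Set V :=
  {u | ∃ w : G.Walk v u, w.length ≤ s}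

theorem self_mem_nbhd {V : Type} (G : SimpleGraph V) (s : ℕ) (v : V) : v ∈ nbhd G s v :=
  ⟨SimpleGraph.Walk.nil, Nat.zero_le s⟩

/-- The depth-`s` neighborhood of `v` in `G`, as a graph (to be rooted at `nbhdRoot G s v`). -/
def nbhdGraph {V : Type} (G : SimpleGraph V) (s : ℕ) (v : V) : SimpleGraph (nbhd G s v) :=
  G.induce (nbhd G s v)

/-- The vertex `v` as the root of its depth-`s` neighborhood. -/
def nbhdRoot {V : Type} (G : SimpleGraph V) (s : ℕ) (v : V) : nbhd G s v :=
  ⟨v, self_mem_nbhd G s v⟩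

theorem hasDepthLE_nbhd {V : Type} (G : SimpleGraph V) (s : ℕ) (v : V) :
    HasDepthLE (nbhdGraph G s v) (nbhdRoot G s v) s := by
  classical
  rintro ⟨u, w, hw⟩
  have hsub : ∀ z ∈ w.support, z ∈ nbhd G s v := fun z hz =>
    ⟨w.takeUntil z hz, (w.length_takeUntil_le_length hz).trans hw⟩
  refine ⟨w.induce (nbhd G s v) hsub, ?_⟩
  have h := congrArg SimpleGraph.Walk.length (SimpleGraph.Walk.map_induce w hsub)
  rw [SimpleGraph.Walk.length_map] at h
  exact h.trans_le hw

/-! ### Local functions -/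

/-- An `s`-local function: it takes a finite rooted graph `(H, r)` of depth at most `s` with
vertex labels `x` in `[0,1]` and returns a bit (`true` is `1`, "in"; `false` is `0`, "out").
It depends only on the isomorphism class of the labelled rooted graph, and is measurable in the
labels. -/
structure LocalFunction (s : ℕ) where
  /-- The output bit. -/
  toFun : ∀ {V : Type} [Finite V] (H : SimpleGraph V) (r : V), HasDepthLE H r s → (V → I) → Bool
  iso_invariant : ∀ {V W : Type} [Finite V] [Finite W] (H : SimpleGraph V) (K : SimpleGraph W)
    (e : H ≃g K) (r : V) (hH : HasDepthLE H r s) (hK : HasDepthLE K (e r) s) (x : W → I),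
    toFun H r hH (fun v => x (e v)) = toFun K (e r) hK x
  measurable_toFun : ∀ {V : Type} [Finite V] (H : SimpleGraph V) (r : V) (h : HasDepthLE H r s),
    Measurable (toFun H r h)

/-- Application of the local function `g` at the vertex `v` of a graph `G` with labels `x`:
`g` is evaluated on the depth-`s` neighborhood of `v` with the restricted labels. -/
def LocalFunction.eval {s : ℕ} (g : LocalFunction s) {V : Type} (G : SimpleGraph V)
    (x : V → I) (v : V) [Finite (nbhd G s v)] : Bool :=
  g.toFun (nbhdGraph G s v) (nbhdRoot G s v) (hasDepthLE_nbhd G s v) (fun u => x u)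

/-- The set of vertices returned by applying `gl` to the vertices in `L` and `gr` to the vertices
outside `L`, in the finite graph `G` with labels `x`. -/
def output {s : ℕ} (gl gr : LocalFunction s) {V : Type} [Finite V] (G : SimpleGraph V)
    (L : Set V) (x : V → I) : Set V :=
  {v | (v ∈ L ∧ gl.eval G x v = true) ∨ (v ∉ L ∧ gr.eval G x v = true)}

/-- The pair `gl`, `gr` is compatible: on every finite bipartite graph with bipartition `(L, Lᶜ)`
and for all labels, the output is an independent set. -/
def Compatible {s : ℕ} (gl gr : LocalFunction s) : Prop :=
  ∀ (V : Type) [Finite V] (G : SimpleGraph V) (L : Set V), G.IsBipartiteWith L Lᶜ →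
    ∀ x : V → I, G.IsIndepSet (output gl gr G L x)

/-! ### Balanced independent sets -/

/-- `J` is a `γ`-balanced independent set of `G`, where `L` is the left side of the bipartition:
`J` is independent and `| |J ∩ L| - γ |J| | < 1`. -/
def IsBalancedIndepSet {V : Type} (G : SimpleGraph V) (L : Set V) (γ : ℝ) (J : Set V) : Prop :=
  G.IsIndepSet J ∧ |((J ∩ L).ncard : ℝ) - γ * (J.ncard : ℝ)| < 1

open Classical in
/-- The size `|X_γ|` of a largest `γ`-balanced independent set contained in `X`. -/
noncomputable def maxBalancedCard {V : Type} [Fintype V] (G : SimpleGraph V) (L : Set V) (γ : ℝ)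
    (X : Set V) : ℕ :=
  ({J : Finset V | (J : Set V) ⊆ X ∧ IsBalancedIndepSet G L γ (J : Set V)} : Finset (Finset V)).sup
    Finset.card

/-! ### The random bipartite graph -/

/-- The bipartite graph with left vertices `Sum.inl i`, right vertices `Sum.inr j`, and an edge
between `Sum.inl i` and `Sum.inr j` exactly when `A (i, j) = true`. -/
def bipGraph {n : ℕ} (A : Fin n × Fin n → Bool) : SimpleGraph (Fin n ⊕ Fin n) where
  Adj u v := (∃ i j, A (i, j) = true ∧ u = Sum.inl i ∧ v = Sum.inr j) ∨
    (∃ i j, A (i, j) = true ∧ u = Sum.inr j ∧ v = Sum.inl i)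
  symm := ⟨by
    rintro u v (⟨i, j, h, hu, hv⟩ | ⟨i, j, h, hu, hv⟩)
    · exact Or.inr ⟨i, j, h, hv, hu⟩
    · exact Or.inl ⟨i, j, h, hv, hu⟩⟩
  loopless := ⟨by
    rintro u (⟨i, j, _, hu, hv⟩ | ⟨i, j, _, hu, hv⟩) <;> simp [hu] at hv⟩

/-- The left side `L` of the vertex set. -/
def leftSide (n : ℕ) : Set (Fin n ⊕ Fin n) := Set.range Sum.inl

/-- The edge probability `d / n` (truncated to `[0,1]`, which matters only for `n < d`). -/
noncomputable def edgeProb (n : ℕ) (d : ℝ≥0) : I :=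
  Set.projIcc (0 : ℝ) 1 zero_le_one ((d : ℝ) / (n : ℝ))

/-- Joint law of the edge indicators of the random bipartite graph on `n + n` vertices with edge
probability `d / n`, and of independent uniform labels on its vertices. -/
noncomputable def graphLabelMeasure (n : ℕ) (d : ℝ≥0) :
    Measure ((Fin n × Fin n → Bool) × (Fin n ⊕ Fin n → I)) :=
  (Measure.pi fun _ : Fin n × Fin n => bernoulliMeasure true false (edgeProb n d)).prod
    (Measure.pi fun _ : Fin n ⊕ Fin n => (volume : Measure I))

/-! ### The Poisson Galton-Watson tree -/

/-- With `N u` the number of children of the potential individual `u` (in Ulam-Harris notation,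
where the children of `u` are `0 :: u, 1 :: u, …`), the word `u` is a vertex of the family tree. -/
def IsTreeVertex (N : List ℕ → ℕ) : List ℕ → Prop
  | [] => True
  | i :: u => IsTreeVertex N u ∧ i < N u

/-- The family tree: its edges join each individual to its children. -/
def gwTree (N : List ℕ → ℕ) : SimpleGraph {u : List ℕ // IsTreeVertex N u} where
  Adj u v := (∃ i, v.1 = i :: u.1) ∨ (∃ i, u.1 = i :: v.1)
  symm := ⟨fun _ _ h => h.symm⟩
  loopless := ⟨by
    rintro u (⟨i, h⟩ | ⟨i, h⟩) <;> exact absurd (congrArg List.length h) (by simp)⟩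

/-- The root of the family tree. -/
def gwRoot (N : List ℕ → ℕ) : {u : List ℕ // IsTreeVertex N u} := ⟨[], trivial⟩

theorem finite_treeLevel (N : List ℕ → ℕ) (k : ℕ) :
    {u : List ℕ | IsTreeVertex N u ∧ u.length = k}.Finite := by
  induction k with
  | zero =>
    refine (Set.finite_singleton ([] : List ℕ)).subset ?_
    rintro u ⟨_, hu⟩
    simpa using hu
  | succ k ih =>
    refine (ih.biUnion fun u _ => (Set.finite_Iio (N u)).image fun i => i :: u).subset ?_
    rintro (_ | ⟨i, u⟩) ⟨hu, hl⟩
    · simp at hl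
    · simp only [Set.mem_iUnion]
      exact ⟨u, ⟨hu.1, by simpa using hl⟩, i, hu.2, rfl⟩

theorem length_le_of_walk (N : List ℕ → ℕ) {u v : {u : List ℕ // IsTreeVertex N u}}
    (w : (gwTree N).Walk u v) : v.1.length ≤ u.1.length + w.length := by
  induction w with
  | nil => simp
  | cons h p ih =>
    rw [SimpleGraph.Walk.length_cons]
    rcases h with ⟨i, h⟩ | ⟨i, h⟩
    · rw [h, List.length_cons] at ih
      omega
    · rw [h, List.length_cons]
      omega

instance finite_gwNbhd (N : List ℕ → ℕ) (s : ℕ) : Finite (nbhd (gwTree N) s (gwRoot N)) := by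
  have h : (⋃ k ∈ Set.Iic s, {u : List ℕ | IsTreeVertex N u ∧ u.length = k}).Finite :=
    (Set.finite_Iic s).biUnion fun k _ => finite_treeLevel N k
  refine Set.Finite.to_subtype (Set.Finite.subset (h.preimage Subtype.val_injective.injOn) ?_)
  rintro u ⟨w, hw⟩
  have hl : u.1.length ≤ 0 + w.length := length_le_of_walk N w
  simp only [Set.mem_preimage, Set.mem_iUnion]
  exact ⟨u.1.length, Set.mem_Iic.2 (by omega), u.2, rfl⟩

/-- Joint law of independent `Pois(d)` offspring numbers, which determine the Galton-Watson tree,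
and of independent uniform labels. -/
noncomputable def gwMeasure (d : ℝ≥0) : Measure ((List ℕ → ℕ) × (List ℕ → I)) :=
  (Measure.infinitePi fun _ : List ℕ => poissonMeasure d).prod
    (Measure.infinitePi fun _ : List ℕ => (volume : Measure I))

/-- The expectation `𝔼[g(T, x)]` of the local function `g`, applied at the root of the `Pois(d)`
Galton-Watson tree `T` with independent uniform labels `x` on its vertices. -/
noncomputable def gwExpectation {s : ℕ} (d : ℝ≥0) (g : LocalFunction s) : ℝ :=
  ∫ ω, (if g.eval (gwTree ω.1) (fun u => ω.2 u.1) (gwRoot ω.1) = true then (1 : ℝ) else 0)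
    ∂(gwMeasure d)

/-- The `γ`-balanced value `(1/2) min {𝔼[gl(T, x)] / γ, 𝔼[gr(T, x)] / (1 - γ)}`. For `γ = 0` the
convention is `1 / γ = ∞`: there is no constraint on the left, and the second term is the value. -/
noncomputable def balancedValue {s : ℕ} (d : ℝ≥0) (γ : ℝ) (gl gr : LocalFunction s) : ℝ :=
  if γ = 0 then 1 / 2 * gwExpectation d gr
  else 1 / 2 * min (1 / γ * gwExpectation d gl) (1 / (1 - γ) * gwExpectation d gr)

end BipLocal

/-! Since subsets of independent sets are independent, `|X_γ|` depends only on the numbers `a` and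
`b` of vertices of `X` on the left and on the right. It is `min (a / γ) (b / (1 - γ))` up to an
error of at most `1 / γ` (`abs_maxBalancedCard_sub_le`), and exactly `b` when `γ = 0`. It remains to
show that `a / n` and `b / n` concentrate at the Galton-Watson expectations (`tendsto_sideCount`).
This is a second moment argument: the outputs at two distinct vertices of one side must be
asymptotically uncorrelated and have the right mean.

The probabilistic input is `eventually_le_graphEvent`: for finitely many distinct vertices of one
side, the probability of each pattern of output bits is at least the product of the tree
probabilities, up to a small error. One-sided bounds suffice, because the tree probabilities of all
patterns sum to `1`, so no mass can be in excess.

For the lower bound, fix a plane forest `K` of depth at most `s` and a numbering `e` of its vertices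
by vertices of the graph, increasing among siblings. The event that the neighborhoods of the roots
are exactly this placed forest has a probability that is bounded below by an explicit product. Such
events are disjoint for different pairs `(K, e)` (`Placement.unique`), and on each of them the
output depends on the labels exactly as on the tree. Multiplied by the number of numberings, the
bound tends to the product of Poisson weights of `K`. Finitely many `K` carry almost all the mass of
the Galton-Watson trees. -/

namespace BipLocal

/-! ### Truncated family trees and evaluation of local functions on them -/

/-- The vertices of the family tree of generation at most `s`. -/
abbrev TreeWord (N : List ℕ → ℕ) (s : ℕ) : Type :=
  {u : List ℕ // IsTreeVertex N u ∧ u.length ≤ s}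

instance finite_treeWord (N : List ℕ → ℕ) (s : ℕ) : Finite (TreeWord N s) := by
  have h : (⋃ k ∈ Set.Iic s, {u : List ℕ | IsTreeVertex N u ∧ u.length = k}).Finite :=
    (Set.finite_Iic s).biUnion fun k _ => finite_treeLevel N k
  refine Set.Finite.to_subtype (h.subset ?_)
  rintro u ⟨hu, hl⟩
  simp only [Set.mem_iUnion]
  exact ⟨u.length, Set.mem_Iic.2 hl, hu, rfl⟩

/-- The family tree truncated at generation `s`. -/
def treeGraph (N : List ℕ → ℕ) (s : ℕ) : SimpleGraph (TreeWord N s) where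
  Adj u v := (∃ i, v.1 = i :: u.1) ∨ (∃ i, u.1 = i :: v.1)
  symm := ⟨fun _ _ h => h.symm⟩
  loopless := ⟨by
    rintro u (⟨i, h⟩ | ⟨i, h⟩) <;> exact absurd (congrArg List.length h) (by simp)⟩

/-- The root of the truncated family tree. -/
def treeRoot (N : List ℕ → ℕ) (s : ℕ) : TreeWord N s := ⟨[], trivial, Nat.zero_le s⟩

/-- The parent of a vertex of the truncated family tree. -/
def TreeWord.parent {N : List ℕ → ℕ} {s i : ℕ} {u : List ℕ}
    (h : IsTreeVertex N (i :: u) ∧ (i :: u).length ≤ s) : TreeWord N s :=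
  ⟨u, h.1.1, (Nat.le_succ _).trans h.2⟩

theorem hasDepthLE_treeGraph (N : List ℕ → ℕ) (s : ℕ) :
    HasDepthLE (treeGraph N s) (treeRoot N s) s := by
  have key : ∀ (u : List ℕ) (h : IsTreeVertex N u ∧ u.length ≤ s),
      ∃ w : (treeGraph N s).Walk (treeRoot N s) ⟨u, h⟩, w.length = u.length := by
    intro u
    induction u with
    | nil => exact fun h => ⟨SimpleGraph.Walk.nil, rfl⟩
    | cons i u ih =>
      intro h
      obtain ⟨w, hw⟩ := ih (TreeWord.parent h).2
      have hadj : (treeGraph N s).Adj (TreeWord.parent h) ⟨i :: u, h⟩ := Or.inl ⟨i, rfl⟩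
      exact ⟨w.concat hadj, (w.length_concat hadj).trans (by rw [hw, List.length_cons])⟩
  rintro ⟨u, h⟩
  obtain ⟨w, hw⟩ := key u h
  exact ⟨w, hw.trans_le h.2⟩

/-- A local function at a vertex can be evaluated on any rooted graph that is embedded around this
vertex and exhausts the neighborhoods of its vertices of rank less than `s`. -/
theorem LocalFunction.eval_eq_of_embedding {s : ℕ} (g : LocalFunction s) {V W : Type} [Finite W]
    {H : SimpleGraph W} {r : W} (hH : HasDepthLE H r s) {G : SimpleGraph V} (φ : H ↪g G)
    (rank : W → ℕ) (hr : rank r = 0) (hadj : ∀ u w, H.Adj u w → rank w ≤ rank u + 1)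
    (hφ : ∀ u, rank u < s → ∀ y, G.Adj (φ u) y → ∃ w, φ w = y) (x : V → I) {v : V}
    (hv : φ r = v) [Finite (nbhd G s v)] :
    g.eval G x v = g.toFun H r hH (fun w => x (φ w)) := by
  subst hv
  have hmem : ∀ w, φ w ∈ nbhd G s (φ r) := by
    intro w
    obtain ⟨p, hp⟩ := hH w
    exact ⟨p.map φ.toHom, by simpa using hp⟩
  -- The rank grows by at most one per step, so a walk of length at most `s` from the root meets
  -- only ranks below `s` before its last vertex. There `hφ` keeps it inside the image of `φ`.
  have hwalk : ∀ (y z : V) (p : G.Walk y z) (u : W), φ u = y → rank u + p.length ≤ s →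
      ∃ w, φ w = z := by
    intro y z p
    induction p with
    | nil => exact fun u hu _ => ⟨u, hu⟩
    | cons h p ih =>
      intro u hu hl
      rw [SimpleGraph.Walk.length_cons] at hl
      subst hu
      obtain ⟨w, rfl⟩ := hφ u (by omega) _ h
      have h2 := hadj u w (φ.map_adj_iff.1 h)
      exact ih w rfl (by omega)
  have hsurj : ∀ y : nbhd G s (φ r), ∃ w, φ w = y.1 := by
    rintro ⟨y, p, hp⟩
    exact hwalk _ _ p r rfl (by omega)
  let e : H ≃g nbhdGraph G s (φ r) :=
    { Equiv.ofBijective (fun w => (⟨φ w, hmem w⟩ : nbhd G s (φ r)))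
        ⟨fun a b hab => φ.injective (congrArg Subtype.val hab), fun y => by
          obtain ⟨w, hw⟩ := hsurj y
          exact ⟨w, Subtype.ext hw⟩⟩ with
      map_rel_iff' := by
        intro a b
        exact φ.map_adj_iff }
  exact (g.iso_invariant H (nbhdGraph G s (φ r)) e r hH (hasDepthLE_nbhd G s (φ r))
    (fun u => x u)).symm

/-- If two offspring functions agree at the vertices of generation less than `s`, then the local
function at the root can be evaluated on the truncated tree of the other one. -/
theorem LocalFunction.eval_gwTree {s : ℕ} (g : LocalFunction s) {N K : List ℕ → ℕ}
    (h : ∀ u, IsTreeVertex K u → u.length < s → N u = K u) (y : List ℕ → I) :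
    g.eval (gwTree N) (fun u => y u.1) (gwRoot N) =
      g.toFun (treeGraph K s) (treeRoot K s) (hasDepthLE_treeGraph K s) (fun u => y u.1) := by
  have hN : ∀ u : List ℕ, IsTreeVertex K u → u.length ≤ s → IsTreeVertex N u := by
    intro u
    induction u with
    | nil => exact fun _ _ => trivial
    | cons i u ih =>
      intro hu hl
      rw [List.length_cons] at hl
      exact ⟨ih hu.1 (by omega), by rw [h u hu.1 (by omega)]; exact hu.2⟩
  let φ : treeGraph K s ↪g gwTree N :=
    { toFun := fun u => ⟨u.1, hN u.1 u.2.1 u.2.2⟩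
      inj' := fun a b hab => Subtype.ext (Subtype.mk.inj hab)
      map_rel_iff' := Iff.rfl }
  refine g.eval_eq_of_embedding (hasDepthLE_treeGraph K s) φ (fun u => u.1.length) rfl ?_ ?_
    (fun u : {u : List ℕ // IsTreeVertex N u} => y u.1) (v := gwRoot N) rfl
  · rintro u w (⟨i, hi⟩ | ⟨i, hi⟩) <;> simp [hi]
    omega
  · rintro u hu ⟨y, hy⟩ (⟨i, hi⟩ | ⟨i, hi⟩)
    · change y = i :: u.1 at hi
      subst hi
      refine ⟨⟨i :: u.1, ⟨u.2.1, ?_⟩, hu⟩, rfl⟩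
      rw [← h u.1 u.2.1 hu]
      exact hy.2
    · change u.1 = i :: y at hi
      have h1 := u.2.1
      have h2 := u.2.2
      rw [hi] at h1 h2
      exact ⟨⟨y, h1.1, (Nat.le_succ _).trans h2⟩, rfl⟩

/-! ### Exploration of the bipartite graph -/

/-- The vertex with number `i` on the left (`b = true`) or right (`b = false`) side. -/
def vtx {n : ℕ} (b : Bool) (i : Fin n) : Fin n ⊕ Fin n := if b then Sum.inl i else Sum.inr i

/-- The index of the potential edge between `vtx b i` and `vtx (!b) j`. -/
def cell {n : ℕ} (b : Bool) (i j : Fin n) : Fin n × Fin n := if b then (i, j) else (j, i)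

theorem vtx_inj {n : ℕ} {b b' : Bool} {i j : Fin n} :
    vtx b i = vtx b' j ↔ b = b' ∧ i = j := by
  cases b <;> cases b' <;> simp [vtx]

theorem exists_vtx {n : ℕ} (y : Fin n ⊕ Fin n) : ∃ b i, y = vtx b i := by
  rcases y with i | i
  · exact ⟨true, i, rfl⟩
  · exact ⟨false, i, rfl⟩

theorem bipGraph_adj_vtx {n : ℕ} (A : Fin n × Fin n → Bool) (b b' : Bool) (i j : Fin n) :
    (bipGraph A).Adj (vtx b i) (vtx b' j) ↔ b' = !b ∧ A (cell b i j) = true := by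
  cases b <;> cases b' <;> simp [bipGraph, vtx, cell]

/-- The side of the vertex that is explored at the word `u`, starting from side `c`. -/
def sideOf (c : Bool) : List ℕ → Bool
  | [] => c
  | _ :: u => !(sideOf c u)

theorem sideOf_eq_of_length_eq (c : Bool) : ∀ u v : List ℕ, u.length = v.length →
    sideOf c u = sideOf c v
  | [], [], _ => rfl
  | _ :: u, _ :: v, h => by
    rw [sideOf, sideOf, sideOf_eq_of_length_eq c u v (by simpa using h)]

theorem sideOf_of_adj (c : Bool) {N : List ℕ → ℕ} {s : ℕ} {u w : TreeWord N s}
    (h : (treeGraph N s).Adj u w) : sideOf c w.1 = !(sideOf c u.1) := by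
  rcases h with ⟨i, h⟩ | ⟨i, h⟩ <;> simp [h, sideOf]

variable {R : Type} {n s : ℕ}

/-- An injective numbering of the vertices of a forest of truncated trees that starts with `ρ` at
the roots and is increasing on siblings. -/
structure Placement (ρ : R → Fin n) (K : R → List ℕ → ℕ) (s : ℕ)
    (e : ∀ r, TreeWord (K r) s → Fin n) : Prop where
  inj : ∀ r u r' u', e r u = e r' u' → r = r' ∧ u.1 = u'.1
  root : ∀ r, e r (treeRoot (K r) s) = ρ r
  mono : ∀ r u i j hi hj, i < j → e r ⟨i :: u, hi⟩ < e r ⟨j :: u, hj⟩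

/-- The neighbors in `bipGraph A` of the placed vertices of generation less than `s` are exactly
their placed tree neighbors. -/
def Explores (A : Fin n × Fin n → Bool) (c : Bool) (K : R → List ℕ → ℕ) (s : ℕ)
    (e : ∀ r, TreeWord (K r) s → Fin n) : Prop :=
  ∀ r (u : TreeWord (K r) s), u.1.length < s → ∀ j,
    A (cell (sideOf c u.1) (e r u) j) = true ↔ ∃ w, (treeGraph (K r) s).Adj u w ∧ e r w = j

/-- The placed tree is an induced subgraph that exhausts the neighborhoods of its vertices of
generation less than `s`, so the embedding criterion applies. -/
theorem LocalFunction.eval_of_explores (g : LocalFunction s) {A : Fin n × Fin n → Bool} {c : Bool}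
    {ρ : R → Fin n} {K : R → List ℕ → ℕ} {e : ∀ r, TreeWord (K r) s → Fin n}
    (he : Placement ρ K s e) (hA : Explores A c K s e) (x : Fin n ⊕ Fin n → I) (r : R) :
    g.eval (bipGraph A) x (vtx c (ρ r)) =
      g.toFun (treeGraph (K r) s) (treeRoot (K r) s) (hasDepthLE_treeGraph (K r) s)
        (fun u => x (vtx (sideOf c u.1) (e r u))) := by
  have hadj : ∀ u w : TreeWord (K r) s, u.1.length < s →
      ((bipGraph A).Adj (vtx (sideOf c u.1) (e r u)) (vtx (sideOf c w.1) (e r w)) ↔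
        (treeGraph (K r) s).Adj u w) := by
    intro u w hu
    rw [bipGraph_adj_vtx, hA r u hu]
    constructor
    · rintro ⟨_, w', hw', h⟩
      rwa [← Subtype.ext (he.inj _ _ _ _ h).2]
    · exact fun h => ⟨sideOf_of_adj c h, w, h, rfl⟩
  let φ : treeGraph (K r) s ↪g bipGraph A :=
    { toFun := fun u => vtx (sideOf c u.1) (e r u)
      inj' := fun a b hab => Subtype.ext (he.inj _ _ _ _ (vtx_inj.1 hab).2).2
      map_rel_iff' := by
        intro u w
        change (bipGraph A).Adj (vtx (sideOf c u.1) (e r u)) (vtx (sideOf c w.1) (e r w)) ↔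
          (treeGraph (K r) s).Adj u w
        by_cases hu : u.1.length < s
        · exact hadj u w hu
        by_cases hw : w.1.length < s
        · rw [(bipGraph A).adj_comm, (treeGraph (K r) s).adj_comm]
          exact hadj w u hw
        -- `Explores` says nothing about pairs of vertices of generation `s`; these lie on the same
        -- side of the bipartition and so are not adjacent.
        have hl : u.1.length = w.1.length := by
          have := u.2.2
          have := w.2.2
          omega
        constructor
        · intro h
          have := ((bipGraph_adj_vtx A _ _ _ _).1 h).1
          rw [sideOf_eq_of_length_eq c _ _ hl] at this
          simp at this
        · rintro (⟨i, h⟩ | ⟨i, h⟩) <;> rw [h] at hl <;> simp at hl }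
  refine g.eval_eq_of_embedding (hasDepthLE_treeGraph (K r) s) φ (fun u => u.1.length) rfl ?_ ?_
    x (by change vtx c (e r (treeRoot (K r) s)) = _; rw [he.root])
  · rintro u w (⟨i, hi⟩ | ⟨i, hi⟩) <;> simp [hi]
    omega
  · intro u hu y hy
    obtain ⟨b, j, rfl⟩ := exists_vtx y
    obtain ⟨rfl, hj⟩ := (bipGraph_adj_vtx A _ _ _ _).1 hy
    obtain ⟨w, hw, rfl⟩ := (hA r u hu j).1 hj
    exact ⟨w, by change vtx (sideOf c w.1) (e r w) = _; rw [sideOf_of_adj c hw]⟩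

theorem strictMono_fin_ext {k k' : ℕ} {f : Fin k → Fin n} {f' : Fin k' → Fin n}
    (hf : StrictMono f) (hf' : StrictMono f') (h : Set.range f = Set.range f') :
    k = k' ∧ ∀ i hi hi', f ⟨i, hi⟩ = f' ⟨i, hi'⟩ := by
  have hk : k = k' := by
    have h1 := Set.ncard_image_of_injective Set.univ hf.injective
    have h2 := Set.ncard_image_of_injective Set.univ hf'.injective
    rw [Set.image_univ, Set.ncard_univ, Nat.card_fin] at h1 h2
    rw [← h1, ← h2, h]
  subst hk
  refine ⟨rfl, fun i hi hi' => ?_⟩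
  rw [(hf.range_inj hf').1 h]

/-- The right-hand side involves only the graph, the vertex and its parent. Hence the set of
children is determined by the placement of earlier generations. -/
theorem Placement.range_children {A : Fin n × Fin n → Bool} {c : Bool}
    {ρ : R → Fin n} {K : R → List ℕ → ℕ} {e : ∀ r, TreeWord (K r) s → Fin n}
    (he : Placement ρ K s e) (hA : Explores A c K s e) {r : R} {u : List ℕ}
    (h : IsTreeVertex (K r) u ∧ u.length ≤ s) (hl : u.length < s) :
    Set.range (fun i : Fin (K r u) => e r ⟨i :: u, ⟨h.1, i.2⟩, hl⟩) =
      {j | A (cell (sideOf c u) (e r ⟨u, h⟩) j) = true ∧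
        ∀ k v (hv : u = k :: v), e r (TreeWord.parent (hv ▸ h)) ≠ j} := by
  ext j
  constructor
  · rintro ⟨i, rfl⟩
    refine ⟨(hA r ⟨u, h⟩ hl _).2 ⟨_, Or.inl ⟨i, rfl⟩, rfl⟩, fun k v hv hj => ?_⟩
    have h1 := (he.inj _ _ _ _ hj).2
    have h2 := congrArg List.length h1
    simp only [TreeWord.parent, hv, List.length_cons] at h2
    omega
  · rintro ⟨hj, hp⟩
    obtain ⟨w, ⟨i, hi⟩ | ⟨i, hi⟩, rfl⟩ := (hA r ⟨u, h⟩ hl j).1 hj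
    · obtain ⟨w, hw⟩ := w
      change w = i :: u at hi
      subst hi
      exact ⟨⟨i, hw.1.2⟩, rfl⟩
    · exact absurd rfl (hp i w.1 hi)

/-- Induction on the generation: the graph determines the set of children of a placed vertex, and
monotonicity on siblings determines their order. Thus a graph explores at most one placed forest
from given roots. -/
theorem Placement.unique {A : Fin n × Fin n → Bool} {c : Bool} {ρ : R → Fin n}
    {K K' : R → List ℕ → ℕ} {e : ∀ r, TreeWord (K r) s → Fin n}
    {e' : ∀ r, TreeWord (K' r) s → Fin n} (he : Placement ρ K s e) (hA : Explores A c K s e)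
    (he' : Placement ρ K' s e') (hA' : Explores A c K' s e') (r : R) (u : List ℕ)
    (h : IsTreeVertex (K r) u ∧ u.length ≤ s) :
    (∃ h', e r ⟨u, h⟩ = e' r ⟨u, h'⟩) ∧ (u.length < s → K r u = K' r u) := by
  have step : ∀ (u : List ℕ) (h : IsTreeVertex (K r) u ∧ u.length ≤ s)
      (h' : IsTreeVertex (K' r) u ∧ u.length ≤ s) (hl : u.length < s),
      e r ⟨u, h⟩ = e' r ⟨u, h'⟩ →
      (∀ k v (hv : u = k :: v),
        e r (TreeWord.parent (hv ▸ h)) = e' r (TreeWord.parent (hv ▸ h'))) →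
      K r u = K' r u ∧ ∀ i hi hi', e r ⟨i :: u, ⟨h.1, hi⟩, hl⟩ = e' r ⟨i :: u, ⟨h'.1, hi'⟩, hl⟩ := by
    intro u h h' hl heq hpar
    have h1 := he.range_children hA h hl
    have h2 := he'.range_children hA' h' hl
    refine strictMono_fin_ext (f := fun i : Fin (K r u) => e r ⟨i :: u, ⟨h.1, i.2⟩, hl⟩)
      (f' := fun i : Fin (K' r u) => e' r ⟨i :: u, ⟨h'.1, i.2⟩, hl⟩)
      (fun i j hij => he.mono _ _ _ _ _ _ hij) (fun i j hij => he'.mono _ _ _ _ _ _ hij) ?_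
    rw [h1, h2, heq]
    ext j
    simp only [Set.mem_ofPred_eq]
    refine and_congr_right fun _ => forall_congr' fun k => forall_congr' fun v =>
      forall_congr' fun hv => ?_
    rw [hpar k v hv]
  -- The induction also carries the agreement at the parent, since the parent is the one neighbor
  -- excluded from the set of children.
  have key : ∀ (u : List ℕ) (h : IsTreeVertex (K r) u ∧ u.length ≤ s),
      ∃ h' : IsTreeVertex (K' r) u ∧ u.length ≤ s, e r ⟨u, h⟩ = e' r ⟨u, h'⟩ ∧
      ∀ k v (hv : u = k :: v),
        e r (TreeWord.parent (hv ▸ h)) = e' r (TreeWord.parent (hv ▸ h')) := by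
    intro u
    induction u with
    | nil =>
      exact fun h => ⟨⟨trivial, h.2⟩, (he.root r).trans (he'.root r).symm,
        fun _ _ hv => by simp at hv⟩
    | cons i u ih =>
      intro h
      have hl : u.length < s := h.2
      obtain ⟨h', heq, hpar⟩ := ih ⟨h.1.1, hl.le⟩
      obtain ⟨hK, hch⟩ := step u ⟨h.1.1, hl.le⟩ h' hl heq hpar
      have hi : i < K' r u := by rw [← hK]; exact h.1.2
      refine ⟨⟨⟨h'.1, hi⟩, h.2⟩, hch i h.1.2 hi, ?_⟩
      rintro k v hv
      cases hv
      exact heq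
  obtain ⟨h', heq, hpar⟩ := key u h
  exact ⟨⟨h', heq⟩, fun hl => (step u h h' hl heq hpar).1⟩

end BipLocal

/-! ### Counting placements and bounding the probability of an exploration -/

namespace BipLocal

variable {R : Type} {n s : ℕ}

/-- The vertices of the family tree of generation less than `s`. -/
abbrev InnerWord (N : List ℕ → ℕ) (s : ℕ) : Type :=
  {u : List ℕ // IsTreeVertex N u ∧ u.length < s}

instance finite_innerWord (N : List ℕ → ℕ) (s : ℕ) : Finite (InnerWord N s) :=
  Finite.of_injective (fun u : InnerWord N s => (⟨u.1, u.2.1, u.2.2.le⟩ : TreeWord N s))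
    fun _ _ h => Subtype.ext (Subtype.mk.inj h)

noncomputable instance fintype_innerWord (N : List ℕ → ℕ) (s : ℕ) : Fintype (InnerWord N s) :=
  Fintype.ofFinite _

noncomputable instance fintype_treeWord (N : List ℕ → ℕ) (s : ℕ) : Fintype (TreeWord N s) :=
  Fintype.ofFinite _

/-- The vertices of generation less than `s` of a forest. -/
abbrev Inner (K : R → List ℕ → ℕ) (s : ℕ) : Type := Σ r, InnerWord (K r) s

/-- The vertices of a forest of truncated trees that are not roots, listed by their parents. -/
abbrev Child (K : R → List ℕ → ℕ) (s : ℕ) : Type := Σ w : Inner K s, Fin (K w.1 w.2.1)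

/-- The numbering of a forest given by its values at the roots and at the other vertices. -/
def place (ρ : R → Fin n) {K : R → List ℕ → ℕ} (f : Child K s → Fin n) :
    ∀ r, TreeWord (K r) s → Fin n
  | r, ⟨[], _⟩ => ρ r
  | r, ⟨i :: u, h⟩ => f ⟨⟨r, ⟨u, h.1.1, h.2⟩⟩, ⟨i, h.1.2⟩⟩

theorem placement_place {ρ : R → Fin n} (hρ : Function.Injective ρ) {K : R → List ℕ → ℕ}
    {f : Child K s → Fin n} (hf : Function.Injective f) (hfρ : ∀ x r, f x ≠ ρ r)
    (hmono : ∀ w : Inner K s, StrictMono fun i => f ⟨w, i⟩) : Placement ρ K s (place ρ f) where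
  inj := by
    rintro r ⟨_ | ⟨i, u⟩, hu⟩ r' ⟨_ | ⟨i', u'⟩, hu'⟩ h
    · exact ⟨hρ h, rfl⟩
    · exact absurd h.symm (hfρ _ _)
    · exact absurd h (hfρ _ _)
    · have := hf h
      simp only [Sigma.mk.injEq] at this
      obtain ⟨⟨rfl, h1⟩, h2⟩ := this
      have h1 := Subtype.mk.inj (eq_of_heq h1)
      subst h1
      have h2 := Fin.mk.inj (eq_of_heq h2)
      subst h2
      exact ⟨rfl, rfl⟩
  root := fun _ => rfl
  mono := fun r u i j hi hj hij => hmono ⟨r, ⟨u, hi.1.1, hi.2⟩⟩ (a := ⟨i, hi.1.2⟩)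
    (b := ⟨j, hj.1.2⟩) hij

theorem place_injective (ρ : R → Fin n) {K : R → List ℕ → ℕ} :
    Function.Injective (place ρ : (Child K s → Fin n) → _) := by
  intro f f' h
  funext ⟨⟨r, u, hu⟩, i, hi⟩
  exact congrFun (congrFun h r) ⟨i :: u, ⟨hu.1, hi⟩, hu.2⟩

variable [Fintype R]

open Nat in
-- Each injection of the non-root vertices into the numbers not used by roots becomes a placement
-- when every set of siblings is sorted. It can be recovered from that placement together with the
-- sorting permutations, which number `K!` at each inner vertex.
theorem descFactorial_le_card_placement {ρ : R → Fin n} (hρ : Function.Injective ρ)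
    (K : R → List ℕ → ℕ) (s : ℕ) :
    (n - Fintype.card R).descFactorial (Fintype.card (Child K s)) ≤
      Nat.card {e // Placement ρ K s e} * ∏ w : Inner K s, (K w.1 w.2.1)! := by
  classical
  let F := Child K s ↪ {j // j ∉ Set.range ρ}
  have hcard : Nat.card F = (n - Fintype.card R).descFactorial (Fintype.card (Child K s)) := by
    rw [Nat.card_eq_fintype_card, Fintype.card_embedding_eq, Fintype.card_subtype_compl]
    congr 2
    · simp
    · exact Set.card_range_of_injective hρ
  let srt : F → ∀ w : Inner K s, Equiv.Perm (Fin (K w.1 w.2.1)) :=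
    fun f w => Tuple.sort fun i => (f ⟨w, i⟩).1
  let sorted : F → Child K s → Fin n := fun f x => (f (Equiv.sigmaCongrRight (srt f) x)).1
  have hsorted : ∀ f, Placement ρ K s (place ρ (sorted f)) := by
    intro f
    refine placement_place hρ ?_ ?_ ?_
    · exact Subtype.val_injective.comp (f.injective.comp (Equiv.injective _))
    · intro x r h
      exact (f (Equiv.sigmaCongrRight (srt f) x)).2 ⟨r, h.symm⟩
    · intro w
      refine (Tuple.monotone_sort fun i => (f ⟨w, i⟩).1).strictMono_of_injective ?_
      refine Function.Injective.comp ?_ (Equiv.injective _)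
      intro i j hij
      have := f.injective (Subtype.ext hij)
      simpa using this
  let Φ : F → {e // Placement ρ K s e} × ∀ w : Inner K s, Equiv.Perm (Fin (K w.1 w.2.1)) :=
    fun f => (⟨place ρ (sorted f), hsorted f⟩, srt f)
  have hΦ : Function.Injective Φ := by
    intro f f' h
    have h1 := place_injective ρ (Subtype.mk.inj (congrArg Prod.fst h))
    have h2 : srt f = srt f' := congrArg Prod.snd h
    ext x
    obtain ⟨y, rfl⟩ := (Equiv.sigmaCongrRight (srt f)).surjective x
    have h3 := congrFun h1 y
    simp only [sorted, ← h2] at h3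
    rw [h3]
  have := Nat.card_le_card_of_injective Φ hΦ
  rw [hcard, Nat.card_prod] at this
  refine this.trans_eq ?_
  congr 1
  rw [Nat.card_eq_fintype_card, Fintype.card_pi]
  exact Finset.prod_congr rfl fun w _ => by rw [Fintype.card_perm, Fintype.card_fin]

/-- The law of the edge indicators. -/
noncomputable abbrev edgeMeasure (n : ℕ) (p : I) : Measure (Fin n × Fin n → Bool) :=
  Measure.pi fun _ => bernoulliMeasure true false p

theorem pow_mul_pow_le_edgeMeasure (p : I) (F D : Finset (Fin n × Fin n)) {a b : ℕ}
    (ha : F.card ≤ a) (hb : D.card ≤ b) :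
    (p : ℝ) ^ a * (1 - p) ^ b ≤
      (edgeMeasure n p).real {A | ∀ x, (x ∈ F → A x = true) ∧ (x ∈ D → x ∉ F → A x = false)} := by
  classical
  have hset : {A : Fin n × Fin n → Bool |
      ∀ x, (x ∈ F → A x = true) ∧ (x ∈ D → x ∉ F → A x = false)} =
      Set.pi Set.univ fun x => if x ∈ F then {true} else if x ∈ D then {false} else Set.univ := by
    ext A
    simp only [Set.mem_ofPred_eq, Set.mem_pi, Set.mem_univ, true_imp_iff]
    refine forall_congr' fun x => ?_
    by_cases h1 : x ∈ F <;> by_cases h2 : x ∈ D <;> simp [h1, h2]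
  have h0 := p.2.1
  have h1 := p.2.2
  have hprod : (edgeMeasure n p).real {A : Fin n × Fin n → Bool |
      ∀ x, (x ∈ F → A x = true) ∧ (x ∈ D → x ∉ F → A x = false)} =
      (∏ x, if x ∈ F then (p : ℝ) else 1) * ∏ x, if x ∈ D \ F then (1 - p : ℝ) else 1 := by
    rw [hset, measureReal_def, Measure.pi_pi, ENNReal.toReal_prod, ← Finset.prod_mul_distrib]
    refine Finset.prod_congr rfl fun x _ => ?_
    rw [← measureReal_def]
    by_cases h1 : x ∈ F <;> by_cases h2 : x ∈ D <;>
      simp [h1, h2]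
  rw [hprod, Finset.prod_ite_mem, Finset.prod_ite_mem, Finset.univ_inter, Finset.univ_inter,
    Finset.prod_const, Finset.prod_const]
  have hD : (D \ F).card ≤ b := (Finset.card_le_card Finset.sdiff_subset).trans hb
  have h2 : (0 : ℝ) ≤ 1 - p := by linarith
  have h3 : (1 : ℝ) - p ≤ 1 := by linarith
  exact mul_le_mul (pow_le_pow_of_le_one h0 h1 ha) (pow_le_pow_of_le_one h2 h3 hD)
    (by positivity) (by positivity)

theorem cell_inj {b b' : Bool} {i j i' j' : Fin n} (h : cell b i j = cell b' i' j') :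
    (b = b' ∧ i = i' ∧ j = j') ∨ (b = !b' ∧ i = j' ∧ j = i') := by
  cases b <;> cases b' <;>
    simp only [cell, Bool.false_eq_true, if_true, if_false, Prod.mk.injEq] at h <;> simp [h]

/-- It suffices that the tree edges `F` are present and that all other pairs `D` at vertices of
generation less than `s` are absent. Pairs may be counted twice in the exponents, which only weakens
the bound. -/
theorem pow_mul_pow_le_explores (p : I) (c : Bool) {ρ : R → Fin n} {K : R → List ℕ → ℕ}
    {e : ∀ r, TreeWord (K r) s → Fin n} (he : Placement ρ K s e) :
    (p : ℝ) ^ Fintype.card (Child K s) * (1 - p) ^ (n * Fintype.card (Inner K s)) ≤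
      (edgeMeasure n p).real {A | Explores A c K s e} := by
  classical
  let inner : Inner K s → Fin n := fun w => e w.1 ⟨w.2.1, w.2.2.1, w.2.2.2.le⟩
  let F : Finset (Fin n × Fin n) := Finset.univ.image fun x : Child K s =>
    cell (sideOf c x.1.2.1) (inner x.1)
      (e x.1.1 ⟨x.2.1 :: x.1.2.1, ⟨x.1.2.2.1, x.2.2⟩, x.1.2.2.2⟩)
  let D : Finset (Fin n × Fin n) := Finset.univ.image fun x : Fin n × Inner K s =>
    cell (sideOf c x.2.2.1) (inner x.2) x.1
  have hF : F.card ≤ Fintype.card (Child K s) := Finset.card_image_le.trans_eq Finset.card_univ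
  have hD : D.card ≤ n * Fintype.card (Inner K s) := by
    refine Finset.card_image_le.trans_eq ?_
    rw [Finset.card_univ, Fintype.card_prod, Fintype.card_fin]
  refine (pow_mul_pow_le_edgeMeasure p F D hF hD).trans (measureReal_mono ?_)
  intro A hA r u hu j
  have hmemD : cell (sideOf c u.1) (e r u) j ∈ D :=
    Finset.mem_image.2 ⟨(j, ⟨r, ⟨u.1, u.2.1, hu⟩⟩), Finset.mem_univ _, rfl⟩
  have hAF : A (cell (sideOf c u.1) (e r u) j) = true ↔ cell (sideOf c u.1) (e r u) j ∈ F := by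
    refine ⟨fun h => ?_, (hA _).1⟩
    by_contra hn
    rw [(hA _).2 hmemD hn] at h
    exact Bool.noConfusion h
  rw [hAF]
  constructor
  · intro h
    obtain ⟨⟨⟨r', v, hv⟩, i, hi⟩, -, hx⟩ := Finset.mem_image.1 h
    -- The same potential edge can be read from either end: in the first case it leads to a child of
    -- `u`, in the second to its parent.
    rcases cell_inj hx with ⟨-, h1, h2⟩ | ⟨-, h1, h2⟩
    · obtain ⟨rfl, h3⟩ := he.inj _ _ _ _ h1
      exact ⟨_, Or.inl ⟨i, by rw [← h3]⟩, h2⟩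
    · obtain ⟨rfl, h3⟩ := he.inj _ _ _ _ h2
      exact ⟨_, Or.inr ⟨i, h3.symm⟩, h1⟩
  · rintro ⟨⟨w, hw⟩, ⟨i, hi⟩ | ⟨i, hi⟩, rfl⟩
    · change w = i :: u.1 at hi
      subst hi
      exact Finset.mem_image.2 ⟨⟨⟨r, ⟨u.1, u.2.1, hu⟩⟩, ⟨i, hw.1.2⟩⟩, Finset.mem_univ _, rfl⟩
    · obtain ⟨u, hu'⟩ := u
      change u = i :: w at hi
      subst hi
      refine Finset.mem_image.2 ⟨⟨⟨r, ⟨w, hw.1, hu'.2⟩⟩, ⟨i, hu'.1.2⟩⟩, Finset.mem_univ _, ?_⟩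
      change cell (sideOf c w) (e r ⟨w, hw⟩) (e r ⟨i :: w, hu'⟩) =
        cell (!sideOf c w) (e r ⟨i :: w, hu'⟩) (e r ⟨w, hw⟩)
      cases sideOf c w <;> rfl

end BipLocal

namespace BipLocal

/-! ### Independent labels along injective maps -/

section Labels

variable {X : Type*} [MeasurableSpace X] (ν : Measure X) [IsProbabilityMeasure ν]

theorem infinitePi_map_comp {ι κ : Type*} {e : κ → ι} (he : Function.Injective e) :
    (Measure.infinitePi fun _ : ι => ν).map (fun x k => x (e k)) =
      Measure.infinitePi fun _ : κ => ν := by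
  classical
  refine Measure.eq_infinitePi _ fun s t ht => ?_
  have hext : ∀ i, Function.extend e t (fun _ => Set.univ) (e i) = t i :=
    fun i => he.extend_apply t _ i
  rw [Measure.map_apply (by fun_prop) (.pi s.countable_toSet fun i _ => ht i)]
  have : (fun (x : ι → X) k => x (e k)) ⁻¹' Set.pi s t =
      Set.pi (s.map ⟨e, he⟩ : Finset ι) (Function.extend e t fun _ => Set.univ) := by
    ext x
    simp [Set.mem_pi, hext]
  rw [this, Measure.infinitePi_pi]
  · simp [Finset.prod_map, hext]
  · intro i hi
    obtain ⟨k, -, rfl⟩ := Finset.mem_map.1 hi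
    simpa [hext] using ht k

theorem infinitePi_real_comp {ι κ : Type*} [Fintype κ] {e : κ → ι} (he : Function.Injective e)
    {B : Set (κ → X)} (hB : MeasurableSet B) :
    (Measure.infinitePi fun _ : ι => ν).real {x | (fun k => x (e k)) ∈ B} =
      (Measure.pi fun _ : κ => ν).real B := by
  rw [← Measure.infinitePi_eq_pi, ← infinitePi_map_comp ν he,
    map_measureReal_apply (by fun_prop) hB]
  rfl

/-- Joint injectivity makes the blocks of coordinates disjoint, hence independent. Applied to the
trees of a placed forest, it factorizes the law of the labels over the roots. -/
theorem pi_real_forall_comp {ι R : Type*} [Fintype ι] [Fintype R] {κ : R → Type*}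
    [∀ r, Fintype (κ r)] {e : ∀ r, κ r → ι}
    (he : Function.Injective fun p : Σ r, κ r => e p.1 p.2)
    {B : ∀ r, Set (κ r → X)} (hB : ∀ r, MeasurableSet (B r)) :
    (Measure.pi fun _ : ι => ν).real {x | ∀ r, (fun k => x (e r k)) ∈ B r} =
      ∏ r, (Measure.pi fun _ : κ r => ν).real (B r) := by
  have h1 := infinitePi_map_comp ν he
  have h2 := Measure.infinitePi_map_piCurry (X := fun (r : R) (_ : κ r) => X)
    (fun (r : R) (_ : κ r) => ν)
  rw [← h1, Measure.map_map (by fun_prop) (by fun_prop)] at h2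
  have h3 : {x : ι → X | ∀ r, (fun k => x (e r k)) ∈ B r} =
      (⇑(MeasurableEquiv.piCurry fun (r : R) (_ : κ r) => X) ∘
        fun (x : ι → X) (k : Σ r, κ r) => x (e k.1 k.2)) ⁻¹' Set.pi Set.univ B := by
    ext x
    simp [Set.mem_pi]
    rfl
  rw [← Measure.infinitePi_eq_pi, h3, ← map_measureReal_apply (by fun_prop) (.univ_pi hB), h2,
    Measure.infinitePi_eq_pi, measureReal_def, Measure.pi_pi, ENNReal.toReal_prod]
  exact Finset.prod_congr rfl fun r _ => by rw [Measure.infinitePi_eq_pi, measureReal_def]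

end Labels

/-! ### Decomposition of the Galton-Watson tree by its shape -/

variable {s : ℕ}

/-- The offspring functions that vanish outside the vertices of generation less than `s`; they
parametrize the plane trees of depth at most `s`. -/
abbrev Shape (s : ℕ) : Type :=
  {K : List ℕ → ℕ // ∀ u, ¬(IsTreeVertex K u ∧ u.length < s) → K u = 0}

/-- A shape is supported on its finitely many vertices of generation less than `s`. Countability
allows the law of the tree to be written as a series over shapes. -/
instance countable_shape (s : ℕ) : Countable (Shape s) := by
  have hfin : ∀ K : Shape s, (Function.support K.1).Finite := by
    intro K
    refine Set.Finite.subset (Set.toFinite (Set.range fun u : InnerWord K.1 s => u.1)) ?_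
    intro u hu
    by_contra h
    exact hu (K.2 u fun hu' => h ⟨⟨u, hu'⟩, rfl⟩)
  refine Function.Injective.countable (f := fun K : Shape s =>
    (Finsupp.ofSupportFinite K.1 (hfin K) : List ℕ →₀ ℕ)) ?_
  intro K K' h
  exact Subtype.ext (congrArg (fun f : List ℕ →₀ ℕ => (f : List ℕ → ℕ)) h)

/-- The offspring functions that agree with `K` on its vertices of generation less than `s`. -/
def cyl (K : List ℕ → ℕ) (s : ℕ) : Set (List ℕ → ℕ) :=
  {N | ∀ u, IsTreeVertex K u → u.length < s → N u = K u}

theorem isTreeVertex_iff_of_mem_cyl {K N : List ℕ → ℕ} (h : N ∈ cyl K s) :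
    ∀ u : List ℕ, u.length ≤ s → (IsTreeVertex N u ↔ IsTreeVertex K u)
  | [], _ => Iff.rfl
  | i :: u, hu => by
    have ih := isTreeVertex_iff_of_mem_cyl h u ((Nat.le_succ _).trans hu)
    constructor
    · rintro ⟨h1, h2⟩
      exact ⟨ih.1 h1, by rwa [← h u (ih.1 h1) hu]⟩
    · rintro ⟨h1, h2⟩
      exact ⟨ih.2 h1, by rwa [h u h1 hu]⟩

/-- The cylinders of distinct shapes are disjoint: `N` fixes the values at inner vertices, and the
values elsewhere are `0` by convention. -/
theorem Shape.eq_of_mem_cyl {K K' : Shape s} {N : List ℕ → ℕ} (h : N ∈ cyl K.1 s)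
    (h' : N ∈ cyl K'.1 s) : K = K' := by
  refine Subtype.ext (funext fun u => ?_)
  by_cases hu : u.length < s
  · have h1 := isTreeVertex_iff_of_mem_cyl h u hu.le
    have h2 := isTreeVertex_iff_of_mem_cyl h' u hu.le
    by_cases hN : IsTreeVertex N u
    · rw [← h u (h1.1 hN) hu, ← h' u (h2.1 hN) hu]
    · rw [K.2 u fun hh => hN (h1.2 hh.1), K'.2 u fun hh => hN (h2.2 hh.1)]
  · rw [K.2 u fun hh => hu hh.2, K'.2 u fun hh => hu hh.2]

theorem exists_shape_mem_cyl (N : List ℕ → ℕ) (s : ℕ) : ∃ K : Shape s, N ∈ cyl K.1 s := by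
  classical
  let K : List ℕ → ℕ := fun u => if IsTreeVertex N u ∧ u.length < s then N u else 0
  have hK : ∀ u, IsTreeVertex K u → IsTreeVertex N u := by
    intro u
    induction u with
    | nil => exact id
    | cons i u ih =>
      rintro ⟨h1, h2⟩
      refine ⟨ih h1, h2.trans_le ?_⟩
      dsimp only [K]
      split_ifs
      · exact le_rfl
      · exact Nat.zero_le _
  have hcyl : N ∈ cyl K s := fun u hu hl => (if_pos ⟨hK u hu, hl⟩).symm
  refine ⟨⟨K, fun u hu => if_neg fun h => hu ⟨?_, h.2⟩⟩, hcyl⟩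
  exact (isTreeVertex_iff_of_mem_cyl hcyl u h.2.le).1 h.1

/-- The value of a local function on the truncated family tree, as a function of the labels. -/
def LocalFunction.onTree (g : LocalFunction s) (K : List ℕ → ℕ) (y : TreeWord K s → I) : Bool :=
  g.toFun (treeGraph K s) (treeRoot K s) (hasDepthLE_treeGraph K s) y

theorem LocalFunction.measurable_onTree (g : LocalFunction s) (K : List ℕ → ℕ) :
    Measurable (g.onTree K) := g.measurable_toFun _ _ _

/-- The probability that the local function has the value `a` on the truncated family tree with
uniform labels. -/
noncomputable def LocalFunction.labelProb (g : LocalFunction s) (K : List ℕ → ℕ) (a : Bool) : ℝ :=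
  (Measure.pi fun _ : TreeWord K s => (volume : Measure I)).real {y | g.onTree K y = a}

/-- The probability that the Galton-Watson tree has the truncation `K`. -/
noncomputable def shapeProb (d : ℝ≥0) (K : List ℕ → ℕ) (s : ℕ) : ℝ :=
  ∏ u : InnerWord K s, (poissonMeasure d).real {K u.1}

/-- The event that the local function has the value `a` at the root of the family tree. -/
def gwEvent (g : LocalFunction s) (a : Bool) : Set ((List ℕ → ℕ) × (List ℕ → I)) :=
  {ω | g.eval (gwTree ω.1) (fun u => ω.2 u.1) (gwRoot ω.1) = a}

theorem gwEvent_eq_iUnion (g : LocalFunction s) (a : Bool) :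
    gwEvent g a =
      ⋃ K : Shape s, cyl K.1 s ×ˢ
        {x | (fun u : TreeWord K.1 s => x u.1) ∈ {y | g.onTree K.1 y = a}} := by
  ext ⟨N, x⟩
  simp only [Set.mem_iUnion, Set.mem_prod, gwEvent, Set.mem_ofPred_eq]
  constructor
  · intro h
    obtain ⟨K, hK⟩ := exists_shape_mem_cyl N s
    refine ⟨K, hK, ?_⟩
    rw [g.eval_gwTree hK] at h
    exact h
  · rintro ⟨K, hK, h⟩
    rw [g.eval_gwTree hK]
    exact h

theorem cyl_eq_preimage (K : List ℕ → ℕ) (s : ℕ) :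
    cyl K s = {N | (fun u : InnerWord K s => N u.1) ∈ Set.pi Set.univ fun u => {K u.1}} := by
  ext N
  simp only [cyl, Set.mem_ofPred_eq, Set.mem_pi, Set.mem_univ, true_imp_iff,
    Set.mem_singleton_iff]
  exact ⟨fun h u => h u.1 u.2.1 u.2.2, fun h u h1 h2 => h ⟨u, h1, h2⟩⟩

theorem measurableSet_cyl (K : List ℕ → ℕ) (s : ℕ) : MeasurableSet (cyl K s) := by
  rw [cyl_eq_preimage]
  exact (MeasurableSet.univ_pi fun u => measurableSet_singleton _).preimage
    (f := fun (N : List ℕ → ℕ) (u : InnerWord K s) => N u.1) (by fun_prop)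

theorem measurableSet_onTree (g : LocalFunction s) (K : List ℕ → ℕ) (a : Bool) :
    MeasurableSet {y | g.onTree K y = a} :=
  g.measurable_onTree K (measurableSet_singleton a)

theorem measurableSet_piece (g : LocalFunction s) (a : Bool) (K : List ℕ → ℕ) :
    MeasurableSet (cyl K s ×ˢ
      {x : List ℕ → I | (fun u : TreeWord K s => x u.1) ∈ {y | g.onTree K y = a}}) :=
  (measurableSet_cyl K s).prod ((measurableSet_onTree g K a).preimage
    (f := fun (x : List ℕ → I) (u : TreeWord K s) => x u.1) (by fun_prop))

theorem measurableSet_gwEvent (g : LocalFunction s) (a : Bool) : MeasurableSet (gwEvent g a) := by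
  rw [gwEvent_eq_iUnion]
  exact MeasurableSet.iUnion fun K => measurableSet_piece g a K.1

instance isProbabilityMeasure_gwMeasure (d : ℝ≥0) : IsProbabilityMeasure (gwMeasure d) := by
  unfold gwMeasure
  infer_instance

theorem gwMeasure_real_piece (d : ℝ≥0) (g : LocalFunction s) (a : Bool) (K : List ℕ → ℕ) :
    (gwMeasure d).real (cyl K s ×ˢ
      {x : List ℕ → I | (fun u : TreeWord K s => x u.1) ∈ {y | g.onTree K y = a}}) =
      shapeProb d K s * g.labelProb K a := by
  rw [gwMeasure, measureReal_prod_prod,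
    infinitePi_real_comp _ Subtype.val_injective (measurableSet_onTree g K a), cyl_eq_preimage,
    infinitePi_real_comp _ Subtype.val_injective
      (MeasurableSet.univ_pi fun u => measurableSet_singleton _), measureReal_def, Measure.pi_pi,
    ENNReal.toReal_prod]
  rfl

/-- The cylinders partition the offspring functions, and on each of them the output depends only on
the finitely many labels of the truncated tree. -/
theorem hasSum_gwEvent (d : ℝ≥0) (g : LocalFunction s) (a : Bool) :
    HasSum (fun K : Shape s => shapeProb d K.1 s * g.labelProb K.1 a)
      ((gwMeasure d).real (gwEvent g a)) := by
  have h : gwMeasure d (gwEvent g a) = ∑' K : Shape s, gwMeasure d (cyl K.1 s ×ˢ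
      {x : List ℕ → I | (fun u : TreeWord K.1 s => x u.1) ∈ {y | g.onTree K.1 y = a}}) := by
    rw [gwEvent_eq_iUnion, measure_iUnion _ fun K : Shape s => measurableSet_piece g a K.1]
    intro K K' hne
    refine Set.disjoint_left.2 fun ω h1 h2 => hne ?_
    exact Shape.eq_of_mem_cyl h1.1 h2.1
  have h2 := ENNReal.hasSum_toReal (h ▸ measure_ne_top (gwMeasure d) (gwEvent g a))
  rw [← ENNReal.tsum_toReal_eq fun _ => measure_ne_top _ _, ← h] at h2
  simpa only [← measureReal_def, gwMeasure_real_piece] using h2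

theorem gwExpectation_eq (d : ℝ≥0) (g : LocalFunction s) :
    gwExpectation d g = (gwMeasure d).real (gwEvent g true) := by
  rw [← integral_indicator_one (measurableSet_gwEvent g true), gwExpectation]
  congr 1 with ω
  simp [Set.indicator_apply, gwEvent]

theorem gwMeasure_real_gwEvent_false (d : ℝ≥0) (g : LocalFunction s) :
    (gwMeasure d).real (gwEvent g false) = 1 - gwExpectation d g := by
  rw [gwExpectation_eq, ← probReal_compl_eq_one_sub (measurableSet_gwEvent g true)]
  congr 1 with ω
  simp [gwEvent]

end BipLocal

/-! ### Asymptotic lower bound for the joint law of outputs at several vertices -/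

namespace BipLocal

variable {R : Type} [Fintype R] {n s : ℕ}

/-- The event that the local function has the values `a r` at the vertices number `ρ r` of one side
of the random graph. -/
def graphEvent (g : LocalFunction s) (c : Bool) (ρ : R → Fin n) (a : R → Bool) :
    Set ((Fin n × Fin n → Bool) × (Fin n ⊕ Fin n → I)) :=
  {ω | ∀ r, g.eval (bipGraph ω.1) ω.2 (vtx c (ρ r)) = a r}

instance isProbabilityMeasure_graphLabelMeasure (n : ℕ) (d : ℝ≥0) :
    IsProbabilityMeasure (graphLabelMeasure n d) := by
  unfold graphLabelMeasure
  infer_instance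

theorem LocalFunction.measurable_eval_bipGraph (g : LocalFunction s) (v : Fin n ⊕ Fin n) :
    Measurable fun ω : (Fin n × Fin n → Bool) × (Fin n ⊕ Fin n → I) =>
      g.eval (bipGraph ω.1) ω.2 v := by
  -- There are finitely many edge configurations, so measurability in the labels for each fixed
  -- graph is enough.
  refine measurable_from_prod_countable_right fun A => ?_
  exact (g.measurable_toFun (nbhdGraph (bipGraph A) s v) (nbhdRoot (bipGraph A) s v)
    (hasDepthLE_nbhd (bipGraph A) s v)).comp
      (g := fun y => _) (f := fun (x : Fin n ⊕ Fin n → I) (u : nbhd (bipGraph A) s v) => x u)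
      (by fun_prop)

theorem measurableSet_graphEvent (g : LocalFunction s) (c : Bool) (ρ : R → Fin n)
    (a : R → Bool) : MeasurableSet (graphEvent g c ρ a) := by
  have : graphEvent g c ρ a =
      ⋂ r, {ω | g.eval (bipGraph ω.1) ω.2 (vtx c (ρ r)) = a r} := by
    ext ω
    simp [graphEvent]
  rw [this]
  exact MeasurableSet.iInter fun r => g.measurable_eval_bipGraph _ (measurableSet_singleton _)

/-- The event that a given forest is explored at given places, and that the labels there give the
local function the values `a`. -/
def placedEvent (g : LocalFunction s) (c : Bool) (a : R → Bool) (K : R → List ℕ → ℕ)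
    (e : ∀ r, TreeWord (K r) s → Fin n) :
    Set ((Fin n × Fin n → Bool) × (Fin n ⊕ Fin n → I)) :=
  {A | Explores A c K s e} ×ˢ
    {x | ∀ r, (fun u : TreeWord (K r) s => x (vtx (sideOf c u.1) (e r u))) ∈
      {y | g.onTree (K r) y = a r}}

theorem measurableSet_placedEvent (g : LocalFunction s) (c : Bool) (a : R → Bool)
    (K : R → List ℕ → ℕ) (e : ∀ r, TreeWord (K r) s → Fin n) :
    MeasurableSet (placedEvent g c a K e) := by
  refine MeasurableSet.prod (Set.toFinite _).measurableSet ?_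
  have : {x : Fin n ⊕ Fin n → I | ∀ r, (fun u : TreeWord (K r) s =>
      x (vtx (sideOf c u.1) (e r u))) ∈ {y | g.onTree (K r) y = a r}} =
      ⋂ r, (fun (x : Fin n ⊕ Fin n → I) (u : TreeWord (K r) s) =>
        x (vtx (sideOf c u.1) (e r u))) ⁻¹' {y | g.onTree (K r) y = a r} := by
    ext x
    simp
  rw [this]
  exact MeasurableSet.iInter fun r => (measurableSet_onTree g (K r) (a r)).preimage (by fun_prop)

omit [Fintype R] in
theorem placedEvent_subset (g : LocalFunction s) (c : Bool) {ρ : R → Fin n} (a : R → Bool)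
    {K : R → List ℕ → ℕ} {e : ∀ r, TreeWord (K r) s → Fin n} (he : Placement ρ K s e) :
    placedEvent g c a K e ⊆ graphEvent g c ρ a := by
  rintro ⟨A, x⟩ ⟨h1, h2⟩ r
  rw [g.eval_of_explores he h1]
  exact h2 r

theorem le_graphLabelMeasure_placedEvent (d : ℝ≥0) (g : LocalFunction s) (c : Bool)
    {ρ : R → Fin n} (a : R → Bool) {K : R → List ℕ → ℕ} {e : ∀ r, TreeWord (K r) s → Fin n}
    (he : Placement ρ K s e) :
    (edgeProb n d : ℝ) ^ Fintype.card (Child K s) *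
        (1 - edgeProb n d) ^ (n * Fintype.card (Inner K s)) * ∏ r, g.labelProb (K r) (a r) ≤
      (graphLabelMeasure n d).real (placedEvent g c a K e) := by
  have hinj : Function.Injective fun p : Σ r, TreeWord (K r) s =>
      (vtx (sideOf c p.2.1) (e p.1 p.2) : Fin n ⊕ Fin n) := by
    rintro ⟨r, u⟩ ⟨r', u'⟩ h
    obtain ⟨rfl, h2⟩ := he.inj _ _ _ _ (vtx_inj.1 h).2
    exact Sigma.ext rfl (heq_of_eq (Subtype.ext h2))
  rw [graphLabelMeasure, placedEvent, measureReal_prod_prod,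
    pi_real_forall_comp (volume : Measure I)
      (e := fun r (u : TreeWord (K r) s) => (vtx (sideOf c u.1) (e r u) : Fin n ⊕ Fin n)) hinj
      (fun r => measurableSet_onTree g (K r) (a r))]
  refine mul_le_mul_of_nonneg_right (pow_mul_pow_le_explores _ c he) ?_
  exact Finset.prod_nonneg fun r _ => measureReal_nonneg

/-- A plane forest of depth at most `s` with a numbering of its vertices. -/
abbrev PlacedForest (ρ : R → Fin n) (s : ℕ) : Type :=
  Σ K : R → Shape s, {e : ∀ r, TreeWord (K r).1 s → Fin n // Placement ρ (fun r => (K r).1) s e}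

omit [Fintype R] in
theorem PlacedForest.eq_of_mem (g : LocalFunction s) (c : Bool) {ρ : R → Fin n} (a : R → Bool)
    {t t' : PlacedForest ρ s} {ω : (Fin n × Fin n → Bool) × (Fin n ⊕ Fin n → I)}
    (h : ω ∈ placedEvent g c a (fun r => (t.1 r).1) t.2.1)
    (h' : ω ∈ placedEvent g c a (fun r => (t'.1 r).1) t'.2.1) : t = t' := by
  obtain ⟨K, e, he⟩ := t
  obtain ⟨K', e', he'⟩ := t'
  have huniq := he.unique h.1 he' h'.1
  have hcyl : ∀ r, (K' r).1 ∈ cyl (K r).1 s :=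
    fun r u hu hl => ((huniq r u ⟨hu, hl.le⟩).2 hl).symm
  have hK : K = K' := funext fun r => Shape.eq_of_mem_cyl (hcyl r) fun u _ _ => rfl
  subst hK
  have he : e = e' := by
    funext r u
    obtain ⟨h', h⟩ := (huniq r u.1 u.2).1
    exact h
  subst he
  rfl

theorem sum_card_placement_le (d : ℝ≥0) (g : LocalFunction s) (c : Bool) (ρ : R → Fin n)
    (a : R → Bool) (F : Finset (R → Shape s)) :
    ∑ K ∈ F, (Nat.card {e // Placement ρ (fun r => (K r).1) s e} : ℝ) *
      ((edgeProb n d : ℝ) ^ Fintype.card (Child (fun r => (K r).1) s) *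
        (1 - edgeProb n d) ^ (n * Fintype.card (Inner (fun r => (K r).1) s)) *
          ∏ r, g.labelProb (K r).1 (a r)) ≤
      (graphLabelMeasure n d).real (graphEvent g c ρ a) := by
  classical
  let S : Finset (PlacedForest ρ s) := F.sigma fun K => Finset.univ
  have h1 : (graphLabelMeasure n d).real
      (⋃ t ∈ S, placedEvent g c a (fun r => (t.1 r).1) t.2.1) =
      ∑ t ∈ S, (graphLabelMeasure n d).real (placedEvent g c a (fun r => (t.1 r).1) t.2.1) := by
    refine measureReal_biUnion_finset ?_ fun t _ => measurableSet_placedEvent _ _ _ _ _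
    intro t _ t' _ hne
    exact Set.disjoint_left.2 fun ω h h' => hne (PlacedForest.eq_of_mem g c a h h')
  have h2 : (⋃ t ∈ S, placedEvent g c a (fun r => (t.1 r).1) t.2.1) ⊆ graphEvent g c ρ a :=
    Set.iUnion₂_subset fun t _ => placedEvent_subset g c a t.2.2
  refine le_trans ?_ (h1.symm.trans_le (measureReal_mono h2))
  rw [Finset.sum_sigma]
  refine Finset.sum_le_sum fun K _ => ?_
  rw [Nat.card_eq_fintype_card, ← Finset.card_univ, ← nsmul_eq_mul]
  exact Finset.card_nsmul_le_sum _ _ _ fun e _ => le_graphLabelMeasure_placedEvent d g c a e.2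

theorem tendsto_descFactorial_div_pow (k m : ℕ) :
    Tendsto (fun n : ℕ => ((n - k).descFactorial m : ℝ) / (n : ℝ) ^ m) atTop (𝓝 1) := by
  induction m with
  | zero => simp
  | succ m ih =>
    have h1 : Tendsto (fun n : ℕ => ((n - k - m : ℕ) : ℝ) / n) atTop (𝓝 1) := by
      have h2 : Tendsto (fun n : ℕ => 1 - ((k + m : ℕ) : ℝ) / n) atTop (𝓝 (1 - 0)) :=
        (tendsto_const_div_atTop_nhds_zero_nat _).const_sub _
      rw [sub_zero] at h2
      refine h2.congr' ?_
      filter_upwards [eventually_ge_atTop (k + m + 1)] with n hn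
      have : (n : ℝ) ≠ 0 := by
        have : n ≠ 0 := by omega
        exact_mod_cast this
      rw [Nat.sub_sub, Nat.cast_sub (by omega)]
      field_simp
    have h3 := h1.mul ih
    rw [mul_one] at h3
    refine h3.congr fun n => ?_
    rw [Nat.descFactorial_succ, Nat.cast_mul, pow_succ']
    exact (mul_div_mul_comm _ _ _ _).symm

theorem edgeProb_eventually_eq (d : ℝ≥0) :
    ∀ᶠ n : ℕ in atTop, (edgeProb n d : ℝ) = d / n := by
  obtain ⟨m, hm⟩ := exists_nat_ge (d : ℝ)
  filter_upwards [eventually_ge_atTop (m + 1)] with n hn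
  have h0 : (0 : ℝ) < n := by exact_mod_cast (by omega : 0 < n)
  have h1 : (d : ℝ) / n ≤ 1 := by
    rw [div_le_one h0]
    exact hm.trans (by exact_mod_cast (by omega : m ≤ n))
  rw [edgeProb, Set.coe_projIcc, min_eq_right h1, max_eq_right (by positivity)]

open Nat in
-- With `m` children in total, about `n ^ m` choices meet the factor `(d / n) ^ m`, and each inner
-- vertex contributes `(1 - d / n) ^ n → exp (-d)`. As `m` is the sum of the offspring numbers, the
-- limit regroups into Poisson weights.
theorem tendsto_placement_weight (d : ℝ≥0) (K : R → List ℕ → ℕ) (s : ℕ) :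
    Tendsto (fun n : ℕ => ((n - Fintype.card R).descFactorial (Fintype.card (Child K s)) : ℝ) /
        (∏ w : Inner K s, ((K w.1 w.2.1)! : ℝ)) *
      ((edgeProb n d : ℝ) ^ Fintype.card (Child K s) *
        (1 - edgeProb n d) ^ (n * Fintype.card (Inner K s)))) atTop
      (𝓝 (∏ r, shapeProb d (K r) s)) := by
  have hlim : ∏ r, shapeProb d (K r) s =
      1 * (d : ℝ) ^ Fintype.card (Child K s) * Real.exp (-d) ^ Fintype.card (Inner K s) /
        ∏ w : Inner K s, ((K w.1 w.2.1)! : ℝ) := by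
    have h1 : Fintype.card (Child K s) = ∑ w : Inner K s, K w.1 w.2.1 := by
      rw [Fintype.card_sigma]
      exact Finset.sum_congr rfl fun w _ => Fintype.card_fin _
    simp only [shapeProb, poissonMeasure_real_singleton]
    rw [← Fintype.prod_sigma' (fun (r : R) (u : InnerWord (K r) s) =>
      Real.exp (-d) * (d : ℝ) ^ K r u.1 / ((K r u.1)! : ℝ)), Finset.prod_div_distrib,
      Finset.prod_mul_distrib, Finset.prod_const, Finset.prod_pow_eq_pow_sum, ← h1,
      Finset.card_univ]
    ring
  rw [hlim]
  have h1 := tendsto_descFactorial_div_pow (Fintype.card R) (Fintype.card (Child K s))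
  have h2 := (Real.tendsto_one_add_div_pow_exp (-(d : ℝ))).pow (Fintype.card (Inner K s))
  refine (((h1.mul_const ((d : ℝ) ^ Fintype.card (Child K s))).mul h2).div_const
    (∏ w : Inner K s, ((K w.1 w.2.1)! : ℝ))).congr' ?_
  filter_upwards [edgeProb_eventually_eq d] with n hn
  rw [hn, ← pow_mul, div_pow, neg_div, ← sub_eq_add_neg]
  ring

open Nat in
-- The threshold for `n` is uniform in `c` and `ρ` because the bound obtained from placements
-- depends on the roots only through their number.
theorem eventually_le_graphEvent (d : ℝ≥0) (g : LocalFunction s) (a : R → Bool) {δ : ℝ}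
    (hδ : 0 < δ) :
    ∀ᶠ n : ℕ in atTop, ∀ (c : Bool) (ρ : R → Fin n), Function.Injective ρ →
      ∏ r, (gwMeasure d).real (gwEvent g (a r)) - δ <
        (graphLabelMeasure n d).real (graphEvent g c ρ a) := by
  classical
  have h1 : Tendsto (fun F : Finset (Shape s) =>
      ∏ r, ∑ K ∈ F, shapeProb d K.1 s * g.labelProb K.1 (a r)) atTop
      (𝓝 (∏ r, (gwMeasure d).real (gwEvent g (a r)))) :=
    tendsto_finsetProd _ fun r _ => hasSum_gwEvent d g (a r)
  -- Truncation to finitely many shapes costs less than `δ`; the limit in `n` can then be taken term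
  -- by term.
  obtain ⟨F, hF⟩ := (h1.eventually (lt_mem_nhds (sub_lt_self _ hδ))).exists
  rw [Finset.prod_univ_sum] at hF
  have h2 : Tendsto (fun n : ℕ => ∑ K ∈ Fintype.piFinset fun _ : R => F,
      ((n - Fintype.card R).descFactorial (Fintype.card (Child (fun r => (K r).1) s)) : ℝ) /
        (∏ w : Inner (fun r => (K r).1) s, (((K w.1).1 w.2.1)! : ℝ)) *
      ((edgeProb n d : ℝ) ^ Fintype.card (Child (fun r => (K r).1) s) *
        (1 - edgeProb n d) ^ (n * Fintype.card (Inner (fun r => (K r).1) s))) *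
          ∏ r, g.labelProb (K r).1 (a r)) atTop
      (𝓝 (∑ K ∈ Fintype.piFinset fun _ : R => F,
        ∏ r, shapeProb d (K r).1 s * g.labelProb (K r).1 (a r))) := by
    refine tendsto_finsetSum _ fun K _ => ?_
    rw [Finset.prod_mul_distrib]
    exact (tendsto_placement_weight d (fun r => (K r).1) s).mul_const _
  filter_upwards [h2.eventually (lt_mem_nhds hF)] with n hn c ρ hρ
  refine hn.trans_le (le_trans (Finset.sum_le_sum fun K _ => ?_)
    (sum_card_placement_le d g c ρ a (Fintype.piFinset fun _ : R => F)))
  have hcard := descFactorial_le_card_placement hρ (fun r => (K r).1) s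
  have hfact : (0 : ℝ) < ∏ w : Inner (fun r => (K r).1) s, (((K w.1).1 w.2.1)! : ℝ) :=
    Finset.prod_pos fun w _ => by exact_mod_cast Nat.factorial_pos _
  have h3 : (0 : ℝ) ≤ ∏ r, g.labelProb (K r).1 (a r) :=
    Finset.prod_nonneg fun r _ => measureReal_nonneg
  have h4 : (0 : ℝ) ≤ edgeProb n d := (edgeProb n d).2.1
  have h5 : (0 : ℝ) ≤ 1 - edgeProb n d := sub_nonneg.2 (edgeProb n d).2.2
  rw [mul_assoc]
  refine mul_le_mul_of_nonneg_right ?_ (by positivity)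
  rw [div_le_iff₀ hfact]
  exact_mod_cast hcard

end BipLocal

namespace BipLocal

variable {n s : ℕ}

/-! ### Concentration of the output -/

/-- The number of vertices of one side of the graph at which the local function has the value
`1`. -/
noncomputable def sideCount (g : LocalFunction s) (c : Bool)
    (ω : (Fin n × Fin n → Bool) × (Fin n ⊕ Fin n → I)) : ℝ :=
  ∑ i : Fin n, if g.eval (bipGraph ω.1) ω.2 (vtx c i) = true then (1 : ℝ) else 0

/-- The deviation of the output bit at a vertex from the expectation on the tree. -/
noncomputable def deviation (d : ℝ≥0) (g : LocalFunction s) (c : Bool) (i : Fin n)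
    (ω : (Fin n × Fin n → Bool) × (Fin n ⊕ Fin n → I)) : ℝ :=
  (if g.eval (bipGraph ω.1) ω.2 (vtx c i) = true then (1 : ℝ) else 0) - gwExpectation d g

theorem gwExpectation_mem_Icc (d : ℝ≥0) (g : LocalFunction s) :
    gwExpectation d g ∈ Set.Icc (0 : ℝ) 1 := by
  rw [gwExpectation_eq]
  exact ⟨measureReal_nonneg, measureReal_le_one⟩

theorem abs_deviation_le (d : ℝ≥0) (g : LocalFunction s) (c : Bool) (i : Fin n)
    (ω : (Fin n × Fin n → Bool) × (Fin n ⊕ Fin n → I)) : |deviation d g c i ω| ≤ 1 := by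
  obtain ⟨h0, h1⟩ := gwExpectation_mem_Icc d g
  rw [deviation, abs_le]
  split_ifs <;> constructor <;> linarith

theorem measurable_deviation (d : ℝ≥0) (g : LocalFunction s) (c : Bool) (i : Fin n) :
    Measurable (deviation d g c i) :=
  (Measurable.ite (g.measurable_eval_bipGraph (vtx c i) (measurableSet_singleton true))
    measurable_const measurable_const).sub measurable_const

theorem integrable_deviation_mul (d : ℝ≥0) (g : LocalFunction s) (c : Bool) (i j : Fin n) :
    Integrable (fun ω => deviation d g c i ω * deviation d g c j ω) (graphLabelMeasure n d) := by
  refine Integrable.of_bound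
    ((measurable_deviation d g c i).mul (measurable_deviation d g c j)).aestronglyMeasurable 1
    (ae_of_all _ fun ω => ?_)
  rw [Real.norm_eq_abs, abs_mul]
  exact mul_le_one₀ (abs_deviation_le d g c i ω) (abs_nonneg _) (abs_deviation_le d g c j ω)

theorem integral_deviation_mul_le_one (d : ℝ≥0) (g : LocalFunction s) (c : Bool) (i j : Fin n) :
    ∫ ω, deviation d g c i ω * deviation d g c j ω ∂(graphLabelMeasure n d) ≤ 1 := by
  refine (integral_mono (integrable_deviation_mul d g c i j) (integrable_const 1)
    fun ω => ?_).trans_eq (by simp)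
  refine (le_abs_self _).trans ?_
  rw [abs_mul]
  exact mul_le_one₀ (abs_deviation_le d g c i ω) (abs_nonneg _) (abs_deviation_le d g c j ω)

/-- Under the product of two tree laws the deviations are independent and centered, so `1 -
deviation * deviation` has mean `1`. It is a combination of the indicators of the four output
patterns with coefficients in `[0, 2]`. Lower bounds on the pattern probabilities therefore bound
its mean below by `1 - 8 * δ`. -/
theorem eventually_integral_deviation_mul_le (d : ℝ≥0) (g : LocalFunction s) {δ : ℝ}
    (hδ : 0 < δ) :
    ∀ᶠ n : ℕ in atTop, ∀ (c : Bool) (i j : Fin n), i ≠ j →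
      ∫ ω, deviation d g c i ω * deviation d g c j ω ∂(graphLabelMeasure n d) ≤ 8 * δ := by
  have hev := eventually_all.2 fun a : Bool → Bool => eventually_le_graphEvent d g a hδ
  filter_upwards [hev] with n hn c i j hij
  set m := gwExpectation d g with hm
  obtain ⟨h0, h1⟩ := gwExpectation_mem_Icc d g
  rw [← hm] at h0 h1
  let ρ : Bool → Fin n := fun b => if b then i else j
  have hρ : Function.Injective ρ := by
    intro b b' h
    cases b <;> cases b' <;> simp [ρ] at h ⊢
    · exact hij h.symm
    · exact hij h
  let val : Bool → ℝ := fun b => (if b then 1 else 0) - m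
  let coef : (Bool → Bool) → ℝ := fun a => 1 - val (a true) * val (a false)
  have hval : ∀ b, |val b| ≤ 1 := by
    intro b
    rw [abs_le]
    cases b <;> simp only [val, Bool.false_eq_true, if_true, if_false] <;> constructor <;> linarith
  have hcoef : ∀ a, 0 ≤ coef a ∧ coef a ≤ 2 := by
    intro a
    have h : |val (a true) * val (a false)| ≤ 1 := by
      rw [abs_mul]
      exact mul_le_one₀ (hval _) (abs_nonneg _) (hval _)
    rw [abs_le] at h
    constructor <;> simp only [coef] <;> linarith
  have hpt : ∀ ω, 1 - deviation d g c i ω * deviation d g c j ω =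
      ∑ a : Bool → Bool, (graphEvent g c ρ a).indicator (fun _ => coef a) ω := by
    intro ω
    rw [Finset.sum_eq_single fun b => g.eval (bipGraph ω.1) ω.2 (vtx c (ρ b))]
    · have hmem : ω ∈ graphEvent g c ρ fun b => g.eval (bipGraph ω.1) ω.2 (vtx c (ρ b)) :=
        fun b => rfl
      rw [Set.indicator_of_mem hmem]
      rfl
    · intro a _ ha
      refine Set.indicator_of_notMem (fun h => ha ?_) _
      exact funext fun b => (h b).symm
    · exact fun h => absurd (Finset.mem_univ _) h
  have hint : 1 - ∫ ω, deviation d g c i ω * deviation d g c j ω ∂(graphLabelMeasure n d) =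
      ∑ a : Bool → Bool, coef a * (graphLabelMeasure n d).real (graphEvent g c ρ a) := by
    have h := integral_sub (integrable_const (1 : ℝ)) (integrable_deviation_mul d g c i j)
    rw [integral_const, probReal_univ, one_smul] at h
    rw [← h]
    simp_rw [hpt]
    rw [integral_finsetSum _ fun a _ =>
      (integrable_const (coef a)).indicator (measurableSet_graphEvent g c ρ a)]
    refine Finset.sum_congr rfl fun a _ => ?_
    rw [integral_indicator_const _ (measurableSet_graphEvent g c ρ a), smul_eq_mul, mul_comm]
  have hlow : ∑ a : Bool → Bool,
      coef a * (∏ r, (gwMeasure d).real (gwEvent g (a r)) - δ) ≤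
      ∑ a : Bool → Bool, coef a * (graphLabelMeasure n d).real (graphEvent g c ρ a) :=
    Finset.sum_le_sum fun a _ =>
      mul_le_mul_of_nonneg_left (hn a c ρ hρ).le (hcoef a).1
  have hsplit : ∀ f : (Bool → Bool) → ℝ, ∑ a, f a =
      ∑ b, ∑ b', f fun r => if r then b else b' := by
    intro f
    rw [← Fintype.sum_prod_type']
    refine Fintype.sum_equiv
      ⟨fun a => (a true, a false), fun p r => if r then p.1 else p.2, ?_, ?_⟩ _ _ ?_
    · intro a
      ext r
      cases r <;> rfl
    · intro p
      rfl
    · intro a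
      congr 1
      ext r
      cases r <;> rfl
  have hP : (gwMeasure d).real (gwEvent g true) = m := (gwExpectation_eq d g).symm
  have hQ : (gwMeasure d).real (gwEvent g false) = 1 - m := gwMeasure_real_gwEvent_false d g
  have hsum : 1 - 8 * δ ≤ ∑ a : Bool → Bool,
      coef a * (∏ r, (gwMeasure d).real (gwEvent g (a r)) - δ) := by
    rw [hsplit]
    simp only [Fintype.sum_bool, Fintype.prod_bool, coef, val, hP, hQ, Bool.false_eq_true, if_true,
      if_false]
    -- The four coefficients sum to `4 - (1 - 2 * m) ^ 2`, so the actual loss is at most `4 * δ`.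
    nlinarith [mul_nonneg hδ.le (sq_nonneg (1 - 2 * m))]
  linarith

theorem sideCount_sub (d : ℝ≥0) (g : LocalFunction s) (c : Bool)
    (ω : (Fin n × Fin n → Bool) × (Fin n ⊕ Fin n → I)) :
    sideCount g c ω - n * gwExpectation d g = ∑ i, deviation d g c i ω := by
  simp [sideCount, deviation, Finset.sum_sub_distrib]

theorem tendsto_sideCount (d : ℝ≥0) (g : LocalFunction s) (c : Bool) {η : ℝ} (hη : 0 < η) :
    Tendsto (fun n : ℕ => (graphLabelMeasure n d)
      {ω | η ≤ |sideCount g c ω / n - gwExpectation d g|}) atTop (𝓝 0) := by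
  have key : Tendsto (fun n : ℕ => (graphLabelMeasure n d).real
      {ω | η ≤ |sideCount g c ω / n - gwExpectation d g|}) atTop (𝓝 0) := by
    refine Metric.tendsto_atTop'.2 fun ε hε => ?_
    -- In Chebyshev's inequality the off-diagonal terms then contribute at most `ε * (η * n) ^ 2 /
    -- 4`, and the diagonal `n` is less than `ε * (η * n) ^ 2 / 2` once `n > 2 / (ε * η ^ 2)`.
    have hδ : 0 < ε * η ^ 2 / 32 := by positivity
    obtain ⟨n₁, hn₁⟩ := eventually_atTop.1 (eventually_integral_deviation_mul_le d g hδ)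
    obtain ⟨n₂, hn₂⟩ := exists_nat_gt (2 / (ε * η ^ 2))
    refine ⟨max n₁ n₂, fun n hn => ?_⟩
    have hint := hn₁ n ((le_max_left _ _).trans hn.le) c
    have hn2 : 2 / (ε * η ^ 2) < n :=
      hn₂.trans_le (by exact_mod_cast (le_max_right _ _).trans hn.le)
    have hpos : (0 : ℝ) < n := lt_of_le_of_lt (by positivity) hn2
    have hsub : {ω : (Fin n × Fin n → Bool) × (Fin n ⊕ Fin n → I) |
        η ≤ |sideCount g c ω / n - gwExpectation d g|} ⊆
        {ω | (η * n) ^ 2 ≤ (∑ i, deviation d g c i ω) ^ 2} := by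
      intro ω hω
      have h1 : sideCount g c ω / n - gwExpectation d g = (∑ i, deviation d g c i ω) / n := by
        rw [← sideCount_sub]
        field_simp
      rw [Set.mem_ofPred_eq, h1, abs_div, abs_of_pos hpos, le_div_iff₀ hpos] at hω
      rw [Set.mem_ofPred_eq, ← sq_abs (∑ i, deviation d g c i ω)]
      exact pow_le_pow_left₀ (by positivity) hω 2
    have hsq : ∀ ω : (Fin n × Fin n → Bool) × (Fin n ⊕ Fin n → I),
        (∑ i, deviation d g c i ω) ^ 2 =
          ∑ i, ∑ j, deviation d g c i ω * deviation d g c j ω := by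
      intro ω
      rw [sq, Finset.sum_mul_sum]
    have hbound : ∫ ω, (∑ i, deviation d g c i ω) ^ 2 ∂(graphLabelMeasure n d) ≤
        n + n ^ 2 * (8 * (ε * η ^ 2 / 32)) := by
      simp_rw [hsq]
      rw [integral_finsetSum _ fun i _ => integrable_finsetSum _ fun j _ =>
        integrable_deviation_mul d g c i j]
      simp_rw [integral_finsetSum Finset.univ fun j _ => integrable_deviation_mul d g c _ j]
      calc ∑ i, ∑ j, ∫ ω, deviation d g c i ω * deviation d g c j ω ∂(graphLabelMeasure n d)
          ≤ ∑ i : Fin n, ∑ j : Fin n, ((if i = j then 1 else 0) + 8 * (ε * η ^ 2 / 32)) := by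
            refine Finset.sum_le_sum fun i _ => Finset.sum_le_sum fun j _ => ?_
            split_ifs with h
            · linarith [integral_deviation_mul_le_one d g c i j]
            · linarith [hint i j h]
        _ = n + n ^ 2 * (8 * (ε * η ^ 2 / 32)) := by
            simp [Finset.sum_add_distrib]
            ring
    have hmarkov := mul_meas_ge_le_integral_of_nonneg (μ := graphLabelMeasure n d)
      (f := fun ω => (∑ i, deviation d g c i ω) ^ 2) (ae_of_all _ fun ω => sq_nonneg _)
      (by
        simp_rw [hsq]
        exact integrable_finsetSum _ fun i _ => integrable_finsetSum _ fun j _ =>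
          integrable_deviation_mul d g c i j) ((η * n) ^ 2)
    have hle := measureReal_mono (μ := graphLabelMeasure n d) hsub
    rw [Real.dist_eq, sub_zero, abs_of_nonneg measureReal_nonneg]
    refine hle.trans_lt ?_
    have h2 : 2 < n * (ε * η ^ 2) := (div_lt_iff₀ (by positivity)).1 hn2
    have h3 : (n : ℝ) + n ^ 2 * (8 * (ε * η ^ 2 / 32)) < (η * n) ^ 2 * ε := by
      nlinarith
    exact lt_of_mul_lt_mul_left ((hmarkov.trans hbound).trans_lt h3) (by positivity)
  have h := ENNReal.tendsto_ofReal key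
  rw [ENNReal.ofReal_zero] at h
  exact h.congr fun n => ofReal_measureReal

/-! ### Largest balanced subsets of an independent set -/

section Balanced

variable {V : Type} [Fintype V] {G : SimpleGraph V} {L X : Set V} {γ : ℝ}

theorem le_maxBalancedCard (J : Finset V) (hJX : (J : Set V) ⊆ X)
    (hJ : IsBalancedIndepSet G L γ (J : Set V)) : J.card ≤ maxBalancedCard G L γ X := by
  classical
  exact Finset.le_sup (f := Finset.card) (Finset.mem_filter.2 ⟨Finset.mem_univ _, hJX, hJ⟩)

theorem exists_card_eq_maxBalancedCard (G : SimpleGraph V) (L : Set V) (γ : ℝ) (X : Set V) :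
    ∃ J : Finset V, (J : Set V) ⊆ X ∧ IsBalancedIndepSet G L γ (J : Set V) ∧
      J.card = maxBalancedCard G L γ X := by
  classical
  have hne : ({J : Finset V | (J : Set V) ⊆ X ∧ IsBalancedIndepSet G L γ (J : Set V)} :
      Finset (Finset V)).Nonempty :=
    ⟨∅, Finset.mem_filter.2 ⟨Finset.mem_univ _, by simp,
      by simp [IsBalancedIndepSet, SimpleGraph.IsIndepSet]⟩⟩
  obtain ⟨J, hJ, h⟩ := Finset.exists_mem_eq_sup _ hne Finset.card
  obtain ⟨h1, h2⟩ := (Finset.mem_filter.1 hJ).2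
  refine ⟨J, h1, h2, ?_⟩
  rw [← h, maxBalancedCard]

/-- Any `p` left and `q` right vertices of `X` form an independent set, so balance is a condition on
the two numbers alone. -/
theorem add_le_maxBalancedCard (hX : G.IsIndepSet X) {p q : ℕ} (hp : p ≤ (X ∩ L).ncard)
    (hq : q ≤ (X \ L).ncard) (hpq : |(p : ℝ) - γ * (p + q : ℕ)| < 1) :
    p + q ≤ maxBalancedCard G L γ X := by
  classical
  rw [Set.ncard_eq_toFinset_card'] at hp hq
  obtain ⟨P, hP, hPc⟩ := Finset.exists_subset_card_eq hp
  obtain ⟨Q, hQ, hQc⟩ := Finset.exists_subset_card_eq hq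
  have hP' : ∀ v ∈ P, v ∈ X ∩ L := fun v hv => Set.mem_toFinset.1 (hP hv)
  have hQ' : ∀ v ∈ Q, v ∈ X \ L := fun v hv => Set.mem_toFinset.1 (hQ hv)
  have hdisj : Disjoint P Q :=
    Finset.disjoint_left.2 fun v h1 h2 => (hQ' v h2).2 (hP' v h1).2
  have hcard : (P ∪ Q).card = p + q := by rw [Finset.card_union_of_disjoint hdisj, hPc, hQc]
  have hsub : ((P ∪ Q : Finset V) : Set V) ⊆ X := by
    intro v hv
    rcases Finset.mem_union.1 (Finset.mem_coe.1 hv) with h | h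
    · exact (hP' v h).1
    · exact (hQ' v h).1
  have hinter : ((P ∪ Q : Finset V) : Set V) ∩ L = P := by
    ext v
    simp only [Set.mem_inter_iff, Finset.mem_coe, Finset.mem_union]
    exact ⟨fun h => h.1.resolve_right fun h' => (hQ' v h').2 h.2, fun h => ⟨Or.inl h, (hP' v h).2⟩⟩
  rw [← hcard]
  refine le_maxBalancedCard _ hsub ⟨fun u hu v hv => hX (hsub hu) (hsub hv), ?_⟩
  rwa [hinter, Set.ncard_coe_finset, Set.ncard_coe_finset, hcard, hPc]

theorem exists_maxBalancedCard_eq (G : SimpleGraph V) (L : Set V) (γ : ℝ) (X : Set V) :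
    ∃ p q : ℕ, p ≤ (X ∩ L).ncard ∧ q ≤ (X \ L).ncard ∧ maxBalancedCard G L γ X = p + q ∧
      |(p : ℝ) - γ * (p + q : ℕ)| < 1 := by
  obtain ⟨J, hJX, ⟨-, hJ⟩, hc⟩ := exists_card_eq_maxBalancedCard G L γ X
  have hcard : ((J : Set V) ∩ L).ncard + ((J : Set V) \ L).ncard = (J : Set V).ncard :=
    Set.ncard_inter_add_ncard_sdiff_eq_ncard _ _
  refine ⟨((J : Set V) ∩ L).ncard, ((J : Set V) \ L).ncard,
    Set.ncard_le_ncard (Set.inter_subset_inter_left L hJX),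
    Set.ncard_le_ncard (Set.sdiff_subset_sdiff_left hJX), ?_, ?_⟩
  · rw [hcard, ← hc, Set.ncard_coe_finset]
  · rwa [hcard]

theorem maxBalancedCard_zero (hX : G.IsIndepSet X) :
    maxBalancedCard G L 0 X = (X \ L).ncard := by
  refine le_antisymm ?_ ?_
  · obtain ⟨p, q, -, hq, h, hpq⟩ := exists_maxBalancedCard_eq G L 0 X
    rw [zero_mul, sub_zero, abs_of_nonneg (Nat.cast_nonneg p)] at hpq
    have : p < 1 := by exact_mod_cast hpq
    omega
  · simpa using add_le_maxBalancedCard (γ := 0) (L := L) hX (p := 0) (Nat.zero_le _) le_rfl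
      (by simp)

theorem abs_maxBalancedCard_sub_le (hX : G.IsIndepSet X) (h0 : 0 < γ) (h1 : γ ≤ 1 / 2) :
    |(maxBalancedCard G L γ X : ℝ) -
      min ((X ∩ L).ncard / γ) ((X \ L).ncard / (1 - γ))| ≤ 1 / γ := by
  have h2 : 0 < 1 - γ := by linarith
  rw [abs_le]
  constructor
  -- Take `m = ⌊t⌋` vertices, `p = ⌊γ * m⌋` of them on the left. Then `m - p < (1 - γ) * m + 1`, and
  -- integrality gives `m - p ≤ (X \ L).ncard`. The loss `t - m` is below `1 ≤ 1 / γ`.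
  · set t := min (((X ∩ L).ncard : ℝ) / γ) ((X \ L).ncard / (1 - γ)) with ht
    have ht0 : 0 ≤ t := le_min (by positivity) (by positivity)
    have hm := Nat.floor_le ht0
    have hm' := Nat.lt_floor_add_one t
    set m := ⌊t⌋₊
    have hma : γ * m ≤ (X ∩ L).ncard := by
      rw [mul_comm, ← le_div_iff₀ h0]
      exact hm.trans (min_le_left _ _)
    have hmb : (1 - γ) * m ≤ (X \ L).ncard := by
      rw [mul_comm, ← le_div_iff₀ h2]
      exact hm.trans (min_le_right _ _)
    have hγm : 0 ≤ γ * m := by positivity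
    have hp := Nat.floor_le hγm
    have hp' := Nat.lt_floor_add_one (γ * m)
    set p := ⌊γ * m⌋₊
    have hpm : p ≤ m := by
      have : (p : ℝ) ≤ m := hp.trans (mul_le_of_le_one_left (Nat.cast_nonneg m) (by linarith))
      exact_mod_cast this
    have hpq : p + (m - p) = m := Nat.add_sub_cancel' hpm
    have hq : m - p ≤ (X \ L).ncard := by
      have : (m : ℝ) < (X \ L).ncard + 1 + p := by linarith
      have : m < (X \ L).ncard + 1 + p := by exact_mod_cast this
      omega
    have hle := add_le_maxBalancedCard (γ := γ) hX (p := p) (q := m - p)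
      (by exact_mod_cast hp.trans hma) hq (by rw [hpq, abs_lt]; constructor <;> linarith)
    rw [hpq] at hle
    have hle' : (m : ℝ) ≤ maxBalancedCard G L γ X := by exact_mod_cast hle
    have : 1 ≤ 1 / γ := by
      rw [le_div_iff₀ h0]
      linarith
    linarith
  -- Balance gives `γ * (p + q) < p + 1` and `(1 - γ) * (p + q) < q + 1`. The second error `1 / (1 -
  -- γ)` is at most `1 / γ` because `γ ≤ 1 / 2`.
  · obtain ⟨p, q, hp, hq, h, hpq⟩ := exists_maxBalancedCard_eq G L γ X
    rw [h, sub_le_iff_le_add, ← min_add_add_left]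
    rw [abs_lt] at hpq
    have hp' : (p : ℝ) ≤ (X ∩ L).ncard := by exact_mod_cast hp
    have hq' : (q : ℝ) ≤ (X \ L).ncard := by exact_mod_cast hq
    push_cast at hpq ⊢
    refine le_min ?_ ?_
    · rw [← add_div, le_div_iff₀ h0]
      linarith
    · have h3 : 1 / (1 - γ) ≤ 1 / γ := one_div_le_one_div_of_le h0 (by linarith)
      refine le_trans ?_ (add_le_add_left h3 _)
      rw [← add_div, le_div_iff₀ h2]
      linarith

end Balanced

/-! ### The output on the random bipartite graph -/

theorem isBipartiteWith_bipGraph (A : Fin n × Fin n → Bool) :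
    (bipGraph A).IsBipartiteWith (leftSide n) (leftSide n)ᶜ where
  disjoint := disjoint_compl_right
  mem_of_adj := by
    rintro v w (⟨i, j, -, rfl, rfl⟩ | ⟨i, j, -, rfl, rfl⟩) <;> simp [leftSide]

theorem ncard_eq_sum (c : Bool) (P : Fin n ⊕ Fin n → Prop) [DecidablePred P]
    {Y : Set (Fin n ⊕ Fin n)} (hY : Y = {v | ∃ i, v = vtx c i ∧ P v}) :
    (Y.ncard : ℝ) = ∑ i : Fin n, if P (vtx c i) then (1 : ℝ) else 0 := by
  have himg : Y = vtx c '' {i | P (vtx c i)} := by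
    rw [hY]
    ext v
    constructor
    · rintro ⟨i, rfl, h⟩
      exact ⟨i, h, rfl⟩
    · rintro ⟨i, h, rfl⟩
      exact ⟨i, rfl, h⟩
  rw [himg, Set.ncard_image_of_injective _ fun i j h => (vtx_inj.1 h).2, Finset.sum_boole]
  congr 1
  rw [← Set.ncard_coe_finset]
  congr 1
  ext i
  simp

theorem ncard_output_inter (gl gr : LocalFunction s)
    (ω : (Fin n × Fin n → Bool) × (Fin n ⊕ Fin n → I)) :
    ((output gl gr (bipGraph ω.1) (leftSide n) ω.2 ∩ leftSide n).ncard : ℝ) =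
      sideCount gl true ω := by
  refine ncard_eq_sum true (fun v => gl.eval (bipGraph ω.1) ω.2 v = true) ?_
  ext (v | v) <;> simp [output, leftSide, vtx]

theorem ncard_output_diff (gl gr : LocalFunction s)
    (ω : (Fin n × Fin n → Bool) × (Fin n ⊕ Fin n → I)) :
    ((output gl gr (bipGraph ω.1) (leftSide n) ω.2 \ leftSide n).ncard : ℝ) =
      sideCount gr false ω := by
  refine ncard_eq_sum false (fun v => gr.eval (bipGraph ω.1) ω.2 v = true) ?_
  ext (v | v) <;> simp [output, leftSide, vtx]

end BipLocal

/-! ### Size of the largest balanced subset of the output -/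

theorem lemma1p4 (d : ℝ≥0) (γ : ℝ) (hγ₀ : 0 ≤ γ) (hγ₁ : γ ≤ 1 / 2) (s : ℕ)
    (gl gr : BipLocal.LocalFunction s) (hg : BipLocal.Compatible gl gr) (ε : ℝ) (hε : 0 < ε) :
    Tendsto (fun n : ℕ =>
        BipLocal.graphLabelMeasure n d
          {ω | ε < |(BipLocal.maxBalancedCard (BipLocal.bipGraph ω.1) (BipLocal.leftSide n) γ
                (BipLocal.output gl gr (BipLocal.bipGraph ω.1) (BipLocal.leftSide n) ω.2) : ℝ)
              / (2 * (n : ℝ)) - BipLocal.balancedValue d γ gl gr|})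
      atTop (𝓝 0) := by
  have hindep : ∀ (n : ℕ) (ω : (Fin n × Fin n → Bool) × (Fin n ⊕ Fin n → I)),
      (BipLocal.bipGraph ω.1).IsIndepSet
        (BipLocal.output gl gr (BipLocal.bipGraph ω.1) (BipLocal.leftSide n) ω.2) :=
    fun n ω => hg _ _ _ (BipLocal.isBipartiteWith_bipGraph ω.1) ω.2
  rcases hγ₀.eq_or_lt with rfl | hγ
  · refine tendsto_of_tendsto_of_tendsto_of_le_of_le tendsto_const_nhds
      (BipLocal.tendsto_sideCount d gr false hε) (fun _ => zero_le) fun n => measure_mono ?_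
    intro ω hω
    rw [Set.mem_ofPred_eq, BipLocal.maxBalancedCard_zero (hindep n ω),
      BipLocal.ncard_output_diff, BipLocal.balancedValue, if_pos rfl] at hω
    have h : BipLocal.sideCount gr false ω / (2 * n) - 1 / 2 * BipLocal.gwExpectation d gr =
        1 / 2 * (BipLocal.sideCount gr false ω / n - BipLocal.gwExpectation d gr) := by
      rw [mul_comm (2 : ℝ), ← div_div]
      ring
    rw [h, abs_mul, abs_of_pos (by norm_num : (0 : ℝ) < 1 / 2)] at hω
    rw [Set.mem_ofPred_eq]
    linarith [abs_nonneg (BipLocal.sideCount gr false ω / n - BipLocal.gwExpectation d gr)]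
  -- Division by `γ`, or by `1 - γ ≥ γ`, turns this tolerance into at most `ε / 2`.
  · have hη : 0 < γ * ε / 2 := by positivity
    have hlim := (BipLocal.tendsto_sideCount d gl true hη).add
      (BipLocal.tendsto_sideCount d gr false hη)
    rw [add_zero] at hlim
    refine tendsto_of_tendsto_of_tendsto_of_le_of_le' tendsto_const_nhds hlim
      (Eventually.of_forall fun _ => zero_le) ?_
    -- For such `n` the deterministic error `1 / γ`, divided by `n`, is below `ε`. The total is
    -- below `2 * ε`, and the factor `1 / 2` of the balanced value brings it below `ε`.
    obtain ⟨n₀, hn₀⟩ := exists_nat_gt (1 / (γ * ε))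
    filter_upwards [eventually_ge_atTop n₀] with n hn
    refine (measure_mono ?_).trans (measure_union_le _ _)
    intro ω hω
    have hn1 : 1 / (γ * ε) < n := hn₀.trans_le (by exact_mod_cast hn)
    have hpos : (0 : ℝ) < n := lt_of_le_of_lt (by positivity) hn1
    rw [div_lt_iff₀ (by positivity)] at hn1
    by_contra hcon
    simp only [Set.mem_union, Set.mem_ofPred_eq, not_or, not_le] at hcon
    obtain ⟨hl, hr⟩ := hcon
    rw [Set.mem_ofPred_eq, BipLocal.balancedValue, if_neg hγ.ne'] at hω
    have hdet := BipLocal.abs_maxBalancedCard_sub_le (L := BipLocal.leftSide n) (hindep n ω) hγ hγ₁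
    rw [BipLocal.ncard_output_inter, BipLocal.ncard_output_diff] at hdet
    set M : ℝ := (BipLocal.maxBalancedCard (BipLocal.bipGraph ω.1) (BipLocal.leftSide n) γ
      (BipLocal.output gl gr (BipLocal.bipGraph ω.1) (BipLocal.leftSide n) ω.2) : ℝ)
    set a := BipLocal.sideCount gl true ω
    set b := BipLocal.sideCount gr false ω
    set x := BipLocal.gwExpectation d gl
    set y := BipLocal.gwExpectation d gr
    have h2 : 0 < 1 - γ := by linarith
    have hmin := abs_min_sub_min_le_max (a / n / γ) (b / n / (1 - γ)) (1 / γ * x)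
      (1 / (1 - γ) * y)
    have hle : max |a / n / γ - 1 / γ * x| |b / n / (1 - γ) - 1 / (1 - γ) * y| ≤ ε / 2 := by
      have e1 : a / n / γ - 1 / γ * x = (a / n - x) / γ := by ring
      have e2 : b / n / (1 - γ) - 1 / (1 - γ) * y = (b / n - y) / (1 - γ) := by ring
      rw [e1, e2, abs_div, abs_div, abs_of_pos hγ, abs_of_pos h2]
      refine max_le ?_ ?_
      · rw [div_le_iff₀ hγ]
        linarith
      · rw [div_le_iff₀ h2]
        nlinarith
    have hscale : min (a / n / γ) (b / n / (1 - γ)) = min (a / γ) (b / (1 - γ)) / n := by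
      rw [← min_div_div_right hpos.le]
      congr 1 <;> ring
    have hM : |M / n - min (a / n / γ) (b / n / (1 - γ))| < ε := by
      rw [hscale, ← sub_div, abs_div, abs_of_pos hpos, div_lt_iff₀ hpos]
      refine hdet.trans_lt ?_
      rw [div_lt_iff₀ hγ]
      linarith
    have hfin : |M / n - min (1 / γ * x) (1 / (1 - γ) * y)| < 2 * ε := by
      have := abs_sub_le (M / n) (min (a / n / γ) (b / n / (1 - γ)))
        (min (1 / γ * x) (1 / (1 - γ) * y))
      linarith
    have hhalf : M / (2 * n) - 1 / 2 * min (1 / γ * x) (1 / (1 - γ) * y) =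
        1 / 2 * (M / n - min (1 / γ * x) (1 / (1 - γ) * y)) := by
      rw [mul_comm (2 : ℝ), ← div_div]
      ring
    rw [hhalf, abs_mul, abs_of_pos (by norm_num : (0 : ℝ) < 1 / 2)] at hω
    linarith
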